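/- Let $\mathbb K$ be $\mathbb R$ or $\mathbb C$, let $G$ be a locally compact Hausdorff group with left Haar measure $ds$ and modular function $\Delta$ (normalized by $\Delta(r)\int_G f(sr)\,ds=\int_G f(s)\,ds$), and let $\mathcal H$ be a non-empty class of Hilbert spaces over $\mathbb K$. Let $\mathcal R$ be the class of all unitary strongly continuous representations of $G$ in the spaces from $\mathcal H$. Equip $C_c(G)=C_c(G,\mathbb K)$ with the convolution $(f*g)(s)=\int_G f(r)g(r^{-1}s)\,dr$ and the involution $f^*(s)=\Delta(s^{-1})\overline{f(s^{-1})}$. For $U\in\mathcal R$ on $X_U$ let $U(f)=\int_G f(s)U_s\,ds\in B(X_U)$, and put $$\sigma^{\mathcal R}(f)=\sup_{U\in\mathcal R}\|U(f)\|\qquad(f\in C_c(G)).$$ Let $(\mathbb K\rtimes_{\mathrm{triv}}G)^{\mathcal R}$ be the $C^*$-algebra obtained by completing $C_c(G)/\ker\sigma^{\mathcal R}$ in the norm induced by $\sigma^{\mathcal R}$ (a real $*$-algebra with a complete norm satisfying the $C^*$-identity if $\mathbb K=\mathbb R$), let $q^{\mathcal R}:C_c(G)\to(\mathbb K\rtimes_{\mathrm{triv}}G)^{\mathcal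 R}$ be the canonical map, and for $U\in\mathcal R$ let $U^{\mathcal R}$ be the involutive representation of $(\mathbb K\rtimes_{\mathrm{triv}}G)^{\mathcal R}$ on $X_U$ determined by continuity and $U^{\mathcal R}(q^{\mathcal R}(f))=U(f)$ for $f\in C_c(G)$. Then $U\mapsto U^{\mathcal R}$ is a bijection from $\mathcal R$ onto the class of all non-degenerate involutive representations of $(\mathbb K\rtimes_{\mathrm{triv}}G)^{\mathcal R}$ in the spaces from $\mathcal H$ (a representation $T$ on $X$ is non-degenerate if the linear span of all vectors $T(a)x$ is dense in $X$). For $U,V\in\mathcal R$, the closed subspaces of $X_U$ invariant under $U$ are exactly those invariant under $U^{\mathcal R}$, and the bounded operators $\Phi:X_U\to X_V$ that intertwine $U$ and $V$ are exactly those that intertwine $U^{\mathcal R}$ and $V^{\mathcal R}$, so that the two Banach spaces of intertwining operators coincide. Moreover, if $\mathcal H$ consists of all Hilbert spaces, then $(\mathbb K\rtimes_{\mathrm{triv}}G)^{\mathcal R}$ is the group $C^*$-algebra $C^*(G)$: for every $f\in C_c(G)$, $\|q^{\mathcal R}(f)\|$ is the supremum of $\|\pi(f)\|$ over all non-degenerate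 involutive representations $\pi$ of $C_c(G)$ in Hilbert spaces with $\|\pi(g)\|\le\|g\|_{L^1(G)}$ for all $g\in C_c(G)$. -/

import Mathlib

set_option linter.unusedSectionVars false
set_option linter.style.haveILetI false

universe w u v

namespace GroupCrossed

open MeasureTheory Measure Set Topology
open scoped CompactlySupported Pointwise

section Modular

variable {G : Type*} [Group G] [TopologicalSpace G] [IsTopologicalGroup G]
  [LocallyCompactSpace G]

/-- The modular function `Δ`, normalised by `Δ r * ∫ f (s * r) ds = ∫ f s ds` for the left Haar
integral. Mathlib's `modularCharacter` is normalised by `∫ f (s * r) ds = Δ r * ∫ f s ds`. -/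
noncomputable def modularFunction (r : G) : ℝ := ((modularCharacter r : NNReal) : ℝ)⁻¹

theorem modularFunction_pos (r : G) : 0 < modularFunction r :=
  inv_pos.2 (NNReal.coe_pos.2 (modularCharacterFun_pos r))

theorem modularFunction_one : modularFunction (1 : G) = 1 := by
  simp [modularFunction]

theorem modularFunction_mul (r s : G) :
    modularFunction (r * s) = modularFunction r * modularFunction s := by
  simp [modularFunction, mul_comm]

theorem modularFunction_inv (r : G) : modularFunction r⁻¹ = (modularFunction r)⁻¹ := by
  refine eq_inv_of_mul_eq_one_left ?_
  rw [← modularFunction_mul, inv_mul_cancel, modularFunction_one]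

variable [MeasurableSpace G] [BorelSpace G] (μ : Measure G) [μ.IsHaarMeasure]

theorem modularFunction_mul_integral (r : G) {f : G → ℝ} (hf : Continuous f)
    (hc : HasCompactSupport f) :
    modularFunction r * ∫ s, f (s * r) ∂μ = ∫ s, f s ∂μ := by
  have h := integral_isMulLeftInvariant_eq_smul_of_hasCompactSupport (map (· * r) μ) μ hf hc
  rw [← modularCharacterFun_eq_haarScalarFactor, integral_smul_nnreal_measure,
    integral_map (by fun_prop) hf.aestronglyMeasurable] at h
  rw [h]
  change (((modularCharacterFun r : NNReal) : ℝ))⁻¹ * (((modularCharacterFun r : NNReal) : ℝ) * _) = _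
  rw [inv_mul_cancel_left₀]
  exact (NNReal.coe_pos.2 (modularCharacterFun_pos r)).ne'

theorem exists_bump : ∃ g : G → ℝ, Continuous g ∧ HasCompactSupport g ∧ 0 < ∫ s, g s ∂μ := by
  obtain ⟨⟨f, f_cont⟩, f_comp, f_nonneg, f_one⟩ :
    ∃ f : C(G, ℝ), HasCompactSupport f ∧ 0 ≤ f ∧ f 1 ≠ 0 := exists_continuous_nonneg_pos 1
  exact ⟨f, f_cont, f_comp,
    f_cont.integral_pos_of_hasCompactSupport_nonneg_nonzero f_comp f_nonneg f_one⟩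

theorem continuous_modularFunction : Continuous (modularFunction : G → ℝ) := by
  borelize G
  let ν : Measure G := haar
  obtain ⟨g, hg, hc, hpos⟩ := exists_bump ν
  have key : ∀ r : G, modularFunction r⁻¹ = (∫ s, g (s * r) ∂ν) / ∫ s, g s ∂ν := by
    intro r
    rw [← modularFunction_mul_integral ν r hg hc, modularFunction_inv]
    have h1 := modularFunction_mul_integral ν r hg hc
    have h2 : (∫ s, g (s * r) ∂ν) ≠ 0 := by
      intro h; rw [h, mul_zero] at h1; exact hpos.ne h1
    have h3 := (modularFunction_pos r).ne'
    field_simp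
  have hcont : Continuous fun r : G => ∫ s, g (s * r) ∂ν := by
    apply continuous_iff_continuousAt.2 (fun x₀ ↦ ?_)
    obtain ⟨t, t_comp, ht⟩ : ∃ t, IsCompact t ∧ t ∈ 𝓝 x₀ := exists_compact_mem_nhds x₀
    have A : ContinuousOn (fun r : G ↦ ∫ s, g (s * r) ∂ν) t := by
      apply continuousOn_integral_of_compact_support
        (k := (fun p : G × G => p.1 * p.2⁻¹) '' (tsupport g ×ˢ t))
      · exact (hc.isCompact.prod t_comp).image (by fun_prop)
      · exact (hg.comp (continuous_snd.mul continuous_fst)).continuousOn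
      · intro p x hp hx
        contrapose! hx
        exact ⟨(x * p, p), ⟨subset_tsupport _ hx, hp⟩, by simp⟩
    exact A.continuousAt ht
  have h : Continuous fun r : G => modularFunction r⁻¹ := by
    simp_rw [key]; exact hcont.div_const _
  have h' := h.comp continuous_inv
  simpa only [Function.comp_def, inv_inv] using h'

theorem swap_integral {E : Type*} [NormedAddCommGroup E] [NormedSpace ℝ E] {F : G → G → E}
    {K L : Set G} (hK : IsCompact K) (hL : IsCompact L) (hF : Continuous fun p : G × G => F p.1 p.2)
    (h : ∀ x y, F x y ≠ 0 → x ∈ K ∧ y ∈ L) :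
    ∫ x, ∫ y, F x y ∂μ ∂μ = ∫ y, ∫ x, F x y ∂μ ∂μ := by
  apply integral_integral_swap_of_hasCompactSupport hF
  refine HasCompactSupport.intro (hK.prod hL) ?_
  rintro ⟨x, y⟩ hxy
  by_contra hne
  exact hxy (h x y hne)

theorem integral_modularFunction_inv {E : Type*} [NormedAddCommGroup E] [NormedSpace ℝ E]
    [CompleteSpace E]
    {f : G → E} (hf : Continuous f) (hc : HasCompactSupport f) :
    ∫ s, modularFunction s⁻¹ • f s⁻¹ ∂μ = ∫ s, f s ∂μ := by
  obtain ⟨g, hg, hgc, hpos⟩ := exists_bump μ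
  have h1 : ∫ s, ∫ t, g s • f (s⁻¹ * t) ∂μ ∂μ = (∫ s, g s ∂μ) • ∫ t, f t ∂μ := by
    have h0 : ∀ s : G, ∫ t, f (s⁻¹ * t) ∂μ = ∫ t, f t ∂μ := fun s =>
      integral_mul_left_eq_self f s⁻¹
    simp_rw [integral_smul, h0, integral_smul_const]
  have h2 : ∫ s, ∫ t, g s • f (s⁻¹ * t) ∂μ ∂μ = ∫ t, ∫ s, g s • f (s⁻¹ * t) ∂μ ∂μ := by
    apply swap_integral μ (K := tsupport g) (L := tsupport g * tsupport f) hgc.isCompact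
      (hgc.isCompact.mul hc.isCompact)
    · fun_prop
    · intro s t h
      have a := subset_tsupport g (left_ne_zero_of_smul h)
      have b := subset_tsupport f (right_ne_zero_of_smul h)
      exact ⟨a, ⟨s, a, _, b, by simp⟩⟩
  have h3 : ∀ t, ∫ s, g s • f (s⁻¹ * t) ∂μ = ∫ s, g (t * s) • f s⁻¹ ∂μ := by
    intro t
    rw [← integral_mul_left_eq_self (μ := μ) _ t]
    simp
  have h4 : ∫ t, ∫ s, g (t * s) • f s⁻¹ ∂μ ∂μ = ∫ s, ∫ t, g (t * s) • f s⁻¹ ∂μ ∂μ := by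
    apply swap_integral μ (K := tsupport g * tsupport f) (L := (tsupport f)⁻¹)
      (hgc.isCompact.mul hc.isCompact) hc.isCompact.inv
    · fun_prop
    · intro t s h
      have a := subset_tsupport g (left_ne_zero_of_smul h)
      have b := subset_tsupport f (right_ne_zero_of_smul h)
      exact ⟨⟨_, a, _, b, by simp⟩, by simpa using b⟩
  have h5 : ∀ s, ∫ t, g (t * s) • f s⁻¹ ∂μ = (∫ t, g t ∂μ) • (modularFunction s⁻¹ • f s⁻¹) := by
    intro s
    rw [integral_smul_const, ← modularFunction_mul_integral μ s hg hgc, smul_smul,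
      modularFunction_inv, mul_right_comm, mul_inv_cancel₀ (modularFunction_pos s).ne', one_mul]
  rw [h2] at h1
  simp_rw [h3] at h1
  rw [h4] at h1
  simp_rw [h5] at h1
  rw [integral_smul] at h1
  exact smul_right_injective _ hpos.ne' h1

end Modular

/-- The space `C_c(G)` of compactly supported continuous `𝕜`-valued functions on `G`. It is a type
synonym that carries the convolution product and involution with respect to the left Haar
measure `μ`, instead of the pointwise ones. -/
def ConvAlg (𝕜 : Type*) [RCLike 𝕜] (G : Type*) [TopologicalSpace G] [MeasurableSpace G]
    (_μ : Measure G) : Type _ := C_c(G, 𝕜)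

namespace ConvAlg

section Linear

variable {𝕜 : Type*} [RCLike 𝕜] {G : Type*} [TopologicalSpace G] [MeasurableSpace G]
  {μ : Measure G}

instance : FunLike (ConvAlg 𝕜 G μ) G 𝕜 := inferInstanceAs (FunLike C_c(G, 𝕜) G 𝕜)

noncomputable instance : AddCommGroup (ConvAlg 𝕜 G μ) := inferInstanceAs (AddCommGroup C_c(G, 𝕜))

noncomputable instance : Module 𝕜 (ConvAlg 𝕜 G μ) := inferInstanceAs (Module 𝕜 C_c(G, 𝕜))

@[ext] theorem ext {f g : ConvAlg 𝕜 G μ} (h : ∀ s, f s = g s) : f = g := DFunLike.ext _ _ h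

@[simp] theorem add_apply (f g : ConvAlg 𝕜 G μ) (s : G) : (f + g) s = f s + g s := rfl

@[simp] theorem zero_apply (s : G) : (0 : ConvAlg 𝕜 G μ) s = 0 := rfl

@[simp] theorem smul_apply (c : 𝕜) (f : ConvAlg 𝕜 G μ) (s : G) : (c • f) s = c * f s := rfl

@[fun_prop] theorem continuous (f : ConvAlg 𝕜 G μ) : Continuous f :=
  ContinuousMap.continuous (CompactlySupportedContinuousMap.toContinuousMap f)

theorem hasCompactSupport (f : ConvAlg 𝕜 G μ) : HasCompactSupport f :=
  CompactlySupportedContinuousMap.hasCompactSupport' f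

/-- The element of `C_c(G)` given by a continuous function with compact support. -/
def mk (f : G → 𝕜) (hf : Continuous f) (hc : HasCompactSupport f) : ConvAlg 𝕜 G μ :=
  (⟨⟨f, hf⟩, hc⟩ : C_c(G, 𝕜))

@[simp] theorem mk_apply (f : G → 𝕜) (hf : Continuous f) (hc : HasCompactSupport f) (s : G) :
    (mk f hf hc : ConvAlg 𝕜 G μ) s = f s := rfl

/-- The `L¹`-norm `∫ ‖f s‖ ds`. -/
noncomputable def l1norm (f : ConvAlg 𝕜 G μ) : ℝ := ∫ s, ‖f s‖ ∂μ

end Linear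

section Algebra

variable {𝕜 : Type*} [RCLike 𝕜] {G : Type*} [Group G] [TopologicalSpace G] [IsTopologicalGroup G]
  [LocallyCompactSpace G] [MeasurableSpace G] [BorelSpace G]
  {μ : Measure G} [μ.IsHaarMeasure]

theorem integrable_smul {E : Type*} [NormedAddCommGroup E] [NormedSpace 𝕜 E] (f : ConvAlg 𝕜 G μ)
    {u : G → E} (hu : Continuous u) : Integrable (fun s => f s • u s) μ :=
  (f.continuous.smul hu).integrable_of_hasCompactSupport f.hasCompactSupport.smul_right

theorem integrable_mul (f : ConvAlg 𝕜 G μ) {u : G → 𝕜} (hu : Continuous u) :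
    Integrable (fun s => f s * u s) μ :=
  integrable_smul f hu

theorem conv_continuous (f g : ConvAlg 𝕜 G μ) :
    Continuous fun s => ∫ r, f r * g (r⁻¹ * s) ∂μ := by
  rw [← continuousOn_univ]
  apply continuousOn_integral_of_compact_support f.hasCompactSupport.isCompact
  · apply Continuous.continuousOn
    have : Continuous fun p : G × G => f p.2 * g (p.2⁻¹ * p.1) := by fun_prop
    exact this
  · intro s r _ hr
    rw [image_eq_zero_of_notMem_tsupport hr, zero_mul]

theorem conv_hasCompactSupport (f g : ConvAlg 𝕜 G μ) :
    HasCompactSupport fun s => ∫ r, f r * g (r⁻¹ * s) ∂μ := by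
  refine HasCompactSupport.intro (K := tsupport f * tsupport g)
    (f.hasCompactSupport.isCompact.mul g.hasCompactSupport.isCompact) fun s hs => ?_
  have : ∀ r, f r * g (r⁻¹ * s) = 0 := by
    intro r
    by_contra h
    exact hs ⟨r, subset_tsupport _ (left_ne_zero_of_mul h), _,
      subset_tsupport _ (right_ne_zero_of_mul h), by simp⟩
  simp [this]

/-- Convolution: `(f * g) s = ∫ f r * g (r⁻¹ * s) dr`. -/
noncomputable instance : Mul (ConvAlg 𝕜 G μ) where
  mul f g := mk (fun s => ∫ r, f r * g (r⁻¹ * s) ∂μ) (conv_continuous f g)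
    (conv_hasCompactSupport f g)

theorem mul_apply (f g : ConvAlg 𝕜 G μ) (s : G) :
    (f * g) s = ∫ r, f r * g (r⁻¹ * s) ∂μ := rfl

theorem conv_assoc (f g h : ConvAlg 𝕜 G μ) : f * g * h = f * (g * h) := by
  ext s
  simp only [mul_apply]
  have h1 : ∀ r, (∫ t, f t * g (t⁻¹ * r) ∂μ) * h (r⁻¹ * s)
      = ∫ t, f t * g (t⁻¹ * r) * h (r⁻¹ * s) ∂μ := fun r => (integral_mul_const _ _).symm
  simp_rw [h1]
  rw [swap_integral μ (K := tsupport f * tsupport g) (L := tsupport f)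
    (f.hasCompactSupport.isCompact.mul g.hasCompactSupport.isCompact) f.hasCompactSupport.isCompact]
  · congr 1
    ext t
    rw [← integral_const_mul, ← integral_mul_left_eq_self _ t]
    congr 1
    ext r
    simp [mul_assoc]
  · fun_prop
  · intro r t hne
    have a := subset_tsupport f (left_ne_zero_of_mul (left_ne_zero_of_mul hne))
    have b := subset_tsupport g (right_ne_zero_of_mul (left_ne_zero_of_mul hne))
    exact ⟨⟨t, a, _, b, by simp⟩, a⟩

noncomputable instance : NonUnitalRing (ConvAlg 𝕜 G μ) where
  left_distrib f g h := by
    ext s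
    simp only [mul_apply, add_apply, mul_add]
    exact integral_add (integrable_mul f (by fun_prop)) (integrable_mul f (by fun_prop))
  right_distrib f g h := by
    ext s
    simp only [mul_apply, add_apply, add_mul]
    exact integral_add (integrable_mul f (by fun_prop)) (integrable_mul g (by fun_prop))
  zero_mul f := by ext s; simp [mul_apply]
  mul_zero f := by ext s; simp [mul_apply]
  mul_assoc := conv_assoc

instance : IsScalarTower 𝕜 (ConvAlg 𝕜 G μ) (ConvAlg 𝕜 G μ) where
  smul_assoc c f g := by
    ext s
    simp only [smul_eq_mul, mul_apply, smul_apply, mul_assoc]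
    exact integral_const_mul _ _

instance : SMulCommClass 𝕜 (ConvAlg 𝕜 G μ) (ConvAlg 𝕜 G μ) where
  smul_comm c f g := by
    ext s
    simp only [smul_eq_mul, mul_apply, smul_apply, mul_left_comm _ c]
    exact (integral_const_mul _ _).symm

theorem star_continuous (f : ConvAlg 𝕜 G μ) :
    Continuous fun s => (modularFunction s⁻¹ : 𝕜) * star (f s⁻¹) := by
  have h : Continuous fun s : G => modularFunction s⁻¹ :=
    continuous_modularFunction.comp continuous_inv
  exact (RCLike.continuous_ofReal.comp h).mul (by fun_prop)

theorem star_hasCompactSupport (f : ConvAlg 𝕜 G μ) :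
    HasCompactSupport fun s => (modularFunction s⁻¹ : 𝕜) * star (f s⁻¹) := by
  refine HasCompactSupport.intro (K := (tsupport f)⁻¹) f.hasCompactSupport.isCompact.inv
    fun s hs => ?_
  have : f s⁻¹ = 0 := image_eq_zero_of_notMem_tsupport (by simpa using hs)
  simp [this]

/-- The involution: `f⋆ s = Δ(s⁻¹) * conj (f s⁻¹)`. -/
noncomputable instance : Star (ConvAlg 𝕜 G μ) where
  star f := mk (fun s => (modularFunction s⁻¹ : 𝕜) * star (f s⁻¹)) (star_continuous f)
    (star_hasCompactSupport f)

theorem star_apply (f : ConvAlg 𝕜 G μ) (s : G) :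
    (star f) s = (modularFunction s⁻¹ : 𝕜) * star (f s⁻¹) := rfl

noncomputable instance : StarRing (ConvAlg 𝕜 G μ) where
  star_involutive f := by
    ext s
    have h : ((modularFunction s : ℝ) : 𝕜) ≠ 0 := by
      exact_mod_cast (modularFunction_pos s).ne'
    simp [star_apply, modularFunction_inv, h]
  star_add f g := by ext s; simp [star_apply, mul_add]
  star_mul f g := by
    ext s
    simp only [star_apply, mul_apply]
    conv_rhs => rw [← integral_mul_left_eq_self _ s]
    simp only [RCLike.star_def, ← integral_conj, mul_inv_rev, inv_inv]
    rw [← integral_const_mul]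
    congr 1
    ext r
    have h : ((modularFunction s : ℝ) : 𝕜) ≠ 0 := by
      exact_mod_cast (modularFunction_pos s).ne'
    have h' : ((modularFunction r : ℝ) : 𝕜) ≠ 0 := by
      exact_mod_cast (modularFunction_pos r).ne'
    simp [modularFunction_inv, modularFunction_mul]
    field_simp

instance : StarModule 𝕜 (ConvAlg 𝕜 G μ) where
  star_smul c f := by ext s; simp [star_apply, mul_left_comm]

end Algebra

end ConvAlg

/-- A (bundled) Hilbert space over `𝕜`. -/
structure HilbertSpace (𝕜 : Type w) [RCLike 𝕜] : Type (max w (v + 1)) where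
  /-- The underlying type. -/
  carrier : Type v
  [normedAddCommGroup : NormedAddCommGroup carrier]
  [innerProductSpace : InnerProductSpace 𝕜 carrier]
  [completeSpace : CompleteSpace carrier]

namespace HilbertSpace

variable {𝕜 : Type w} [RCLike 𝕜]

instance : CoeSort (HilbertSpace.{w, v} 𝕜) (Type v) := ⟨HilbertSpace.carrier⟩

instance (X : HilbertSpace.{w, v} 𝕜) : NormedAddCommGroup X := X.normedAddCommGroup

instance (X : HilbertSpace.{w, v} 𝕜) : InnerProductSpace 𝕜 X := X.innerProductSpace

instance (X : HilbertSpace.{w, v} 𝕜) : CompleteSpace X := X.completeSpace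

/-- The underlying real normed space, which the vector-valued integral refers to. -/
noncomputable instance (X : HilbertSpace.{w, v} 𝕜) : NormedSpace ℝ X :=
  NormedSpace.restrictScalars ℝ 𝕜 X

instance (X : HilbertSpace.{w, v} 𝕜) : IsScalarTower ℝ 𝕜 X where
  smul_assoc a b x := by
    rw [Algebra.smul_def, mul_smul]
    rfl

theorem real_smul_eq (X : HilbertSpace.{w, v} 𝕜) (a : ℝ) (x : X) : a • x = (a : 𝕜) • x := by
  rw [← one_smul 𝕜 x, ← smul_assoc, RCLike.real_smul_eq_coe_mul, mul_one, one_smul]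

instance (X : HilbertSpace.{w, v} 𝕜) : SMulCommClass ℝ 𝕜 X where
  smul_comm a b x := by rw [real_smul_eq, real_smul_eq, smul_comm]

end HilbertSpace

section Rep

variable {𝕜 : Type w} [RCLike 𝕜] (G : Type u) [Group G] [TopologicalSpace G]

/-- A unitary strongly continuous representation of `G` on the Hilbert space `X`. -/
structure UnitaryRep (X : HilbertSpace.{w, v} 𝕜) where
  /-- The underlying homomorphism into the unitary group of `X`. -/
  toHom : G →* unitary (X →L[𝕜] X)
  continuous_apply' : ∀ x : X, Continuous fun s => (toHom s : X →L[𝕜] X) x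

end Rep

namespace UnitaryRep

section Basic

variable {𝕜 : Type w} [RCLike 𝕜] {G : Type u} [Group G] [TopologicalSpace G]
  {X : HilbertSpace.{w, v} 𝕜}

noncomputable instance : CoeFun (UnitaryRep G X) fun _ => G → (X →L[𝕜] X) :=
  ⟨fun U s => (U.toHom s : X →L[𝕜] X)⟩

@[ext] theorem ext {U V : UnitaryRep G X} (h : ∀ s, U s = V s) : U = V := by
  cases U; cases V
  congr 1
  ext1 s
  exact Subtype.ext (h s)

theorem map_mul (U : UnitaryRep G X) (r s : G) : U (r * s) = U r * U s := by simp

theorem map_one (U : UnitaryRep G X) : U 1 = 1 := by simp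

theorem continuous_apply (U : UnitaryRep G X) (x : X) : Continuous fun s => U s x :=
  U.continuous_apply' x

theorem inner_inv_left (U : UnitaryRep G X) (s : G) (x y : X) :
    inner 𝕜 (U s⁻¹ x) y = inner 𝕜 x (U s y) := by
  have h : U s⁻¹ = star (U s) := by
    simp [_root_.map_inv, ← Unitary.star_eq_inv]
  rw [h, ContinuousLinearMap.star_eq_adjoint, ContinuousLinearMap.adjoint_inner_left]

theorem norm_apply (U : UnitaryRep G X) (s : G) (x : X) : ‖U s x‖ = ‖x‖ := by
  have h : inner 𝕜 (U s x) (U s x) = inner 𝕜 x x := by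
    rw [← inner_inv_left, ← mul_apply_eq_comp, ← map_mul, inv_mul_cancel, map_one,
      one_apply_eq_self]
  rw [@norm_eq_sqrt_re_inner 𝕜, h, ← @norm_eq_sqrt_re_inner 𝕜]

end Basic

section Integrated

variable {𝕜 : Type w} [RCLike 𝕜] {G : Type u} [Group G] [TopologicalSpace G]
  [IsTopologicalGroup G] [LocallyCompactSpace G] [MeasurableSpace G] [BorelSpace G]
  {μ : Measure G} [μ.IsHaarMeasure] {X : HilbertSpace.{w, v} 𝕜}

/-- The operator `U(f) = ∫ f s • U s ds`, given by `U(f) x = ∫ f s • U s x ds` for `x` in `X`. -/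
noncomputable def integral (U : UnitaryRep G X) (f : ConvAlg 𝕜 G μ) : X →L[𝕜] X :=
  LinearMap.mkContinuous
    { toFun := fun x => ∫ s, f s • U s x ∂μ
      map_add' := fun x y => by
        simp only [_root_.map_add, smul_add]
        exact integral_add (f.integrable_smul (U.continuous_apply x))
          (f.integrable_smul (U.continuous_apply y))
      map_smul' := fun c x => by
        simp only [_root_.map_smul, smul_comm _ c, RingHom.id_apply]
        exact integral_smul c _ }
    f.l1norm
    (fun x => by
      refine (norm_integral_le_integral_norm _).trans (le_of_eq ?_)
      simp only [norm_smul, norm_apply]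
      exact integral_mul_const _ _)

theorem integral_apply (U : UnitaryRep G X) (f : ConvAlg 𝕜 G μ) (x : X) :
    U.integral f x = ∫ s, f s • U s x ∂μ := rfl

theorem norm_integral_le (U : UnitaryRep G X) (f : ConvAlg 𝕜 G μ) :
    ‖U.integral f‖ ≤ f.l1norm :=
  LinearMap.mkContinuous_norm_le _ (integral_nonneg fun _ => norm_nonneg _) _

theorem integral_add' (U : UnitaryRep G X) (f g : ConvAlg 𝕜 G μ) :
    U.integral (f + g) = U.integral f + U.integral g := by
  ext x
  simp only [integral_apply, ConvAlg.add_apply, add_smul, _root_.add_apply]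
  exact integral_add (f.integrable_smul (U.continuous_apply x))
    (g.integrable_smul (U.continuous_apply x))

theorem integral_smul' (U : UnitaryRep G X) (c : 𝕜) (f : ConvAlg 𝕜 G μ) :
    U.integral (c • f) = c • U.integral f := by
  ext x
  simp only [integral_apply, ConvAlg.smul_apply, mul_smul, _root_.smul_apply]
  exact integral_smul c _

theorem integral_mul' (U : UnitaryRep G X) (f g : ConvAlg 𝕜 G μ) :
    U.integral (f * g) = U.integral f * U.integral g := by
  ext x
  simp only [integral_apply, ConvAlg.mul_apply, mul_apply_eq_comp]
  have h1 : ∀ s, (∫ r, f r * g (r⁻¹ * s) ∂μ) • U s x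
      = ∫ r, (f r * g (r⁻¹ * s)) • U s x ∂μ := fun s => (integral_smul_const _ _).symm
  simp_rw [h1]
  have hU := U.continuous_apply x
  rw [swap_integral μ (K := tsupport f * tsupport g) (L := tsupport f)
    (f.hasCompactSupport.isCompact.mul g.hasCompactSupport.isCompact) f.hasCompactSupport.isCompact]
  · congr 1
    ext r
    rw [← ContinuousLinearMap.integral_comp_comm _ (g.integrable_smul hU), ← integral_smul,
      ← integral_mul_left_eq_self _ r]
    congr 1
    ext s
    simp [mul_smul]
  · have : Continuous fun p : G × G => U p.1 x := hU.comp continuous_fst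
    fun_prop
  · intro s r hne
    have a := subset_tsupport f (left_ne_zero_of_mul (left_ne_zero_of_smul hne))
    have b := subset_tsupport g (right_ne_zero_of_mul (left_ne_zero_of_smul hne))
    exact ⟨⟨r, a, _, b, by simp⟩, a⟩

theorem integral_star' (U : UnitaryRep G X) (f : ConvAlg 𝕜 G μ) :
    U.integral (star f) = star (U.integral f) := by
  rw [ContinuousLinearMap.star_eq_adjoint, ContinuousLinearMap.eq_adjoint_iff]
  intro x y
  have hc : Continuous fun s => U s⁻¹ x := (U.continuous_apply x).comp continuous_inv
  have hcont : Continuous fun s => star (f s) • U s⁻¹ x := by fun_prop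
  have hsupp : HasCompactSupport fun s => star (f s) • U s⁻¹ x :=
    HasCompactSupport.smul_right (f.hasCompactSupport.comp_left (star_zero 𝕜))
  have h1 : U.integral (star f) x = ∫ s, star (f s) • U s⁻¹ x ∂μ := by
    rw [integral_apply, ← integral_modularFunction_inv μ hcont hsupp]
    congr 1
    ext s
    rw [inv_inv, ConvAlg.star_apply, mul_smul, HilbertSpace.real_smul_eq]
  have hi : Integrable (fun s => star (f s) • U s⁻¹ x) μ :=
    hcont.integrable_of_hasCompactSupport hsupp
  have hi' := f.integrable_smul (μ := μ) (U.continuous_apply y)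
  rw [h1, integral_apply, ← integral_inner hi', ← inner_conj_symm, ← integral_inner hi,
    ← integral_conj]
  congr 1
  ext s
  rw [inner_conj_symm, inner_smul_left, inner_smul_right, inner_inv_left]
  simp

/-- The integrated form `f ↦ U(f) = ∫ f s • U s ds` of `U`, as an involutive representation of the
convolution algebra `C_c(G)`. -/
noncomputable def integratedForm (U : UnitaryRep G X) : ConvAlg 𝕜 G μ →⋆ₙₐ[𝕜] (X →L[𝕜] X) where
  toFun := U.integral
  map_smul' := U.integral_smul'
  map_zero' := by ext x; simp [integral_apply]
  map_add' := U.integral_add'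
  map_mul' := U.integral_mul'
  map_star' := U.integral_star'

theorem integratedForm_apply (U : UnitaryRep G X) (f : ConvAlg 𝕜 G μ) (x : X) :
    U.integratedForm f x = ∫ s, f s • U s x ∂μ := rfl

theorem norm_integratedForm_le (U : UnitaryRep G X) (f : ConvAlg 𝕜 G μ) :
    ‖U.integratedForm f‖ ≤ f.l1norm := U.norm_integral_le f

end Integrated

end UnitaryRep

section Completion

open UniformSpace Completion

variable (A : Type*) [NonUnitalSeminormedRing A]

/-- The product on the completion of a seminormed algebra: the continuous extension. -/
noncomputable abbrev completionMul : Mul (Completion A) where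
  mul := Function.curry <| (isDenseInducing_coe.prodMap isDenseInducing_coe).extend
    ((↑) ∘ Function.uncurry (fun a b : A => a * b))

theorem completion_coe_mul (a b : A) : letI := completionMul A
    ((a * b : A) : Completion A) = (a : Completion A) * (b : Completion A) :=
  ((isDenseInducing_coe.prodMap isDenseInducing_coe).extend_eq
      ((continuous_coe A).comp (@continuous_mul A _ _ _)) (a, b)).symm

theorem completion_continuousMul : letI := completionMul A
    ContinuousMul (Completion A) := by
  let := completionMul A
  constructor
  let m := (AddMonoidHom.mul : A →+ A →+ A).compr₂ toCompl
  have : Continuous fun p : A × A => m p.1 p.2 := (continuous_coe A).comp continuous_mul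
  have di : IsDenseInducing (toCompl : A → Completion A) := isDenseInducing_coe
  exact (di.extend_Z_bilin di this :)

/-- The completion of a seminormed algebra is a Banach algebra. -/
noncomputable abbrev completionNonUnitalNormedRing : NonUnitalNormedRing (Completion A) :=
  letI := completionMul A
  haveI := completion_continuousMul A
  have cm := completion_coe_mul A
  { (inferInstance : NormedAddCommGroup (Completion A)), completionMul A with
    zero_mul := fun a =>
      Completion.induction_on a (isClosed_eq (by fun_prop) continuous_const)
        fun a => by rw [← Completion.coe_zero, ← cm, zero_mul]
    mul_zero := fun a =>
      Completion.induction_on a (isClosed_eq (by fun_prop) continuous_const)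
        fun a ↦ by rw [← Completion.coe_zero, ← cm, mul_zero]
    mul_assoc := fun a b c =>
      Completion.induction_on₃ a b c
        (isClosed_eq (by fun_prop) (by fun_prop))
        fun a b c => by rw [← cm, ← cm, ← cm, ← cm, mul_assoc]
    left_distrib := fun a b c =>
      Completion.induction_on₃ a b c
        (isClosed_eq (by fun_prop) (by fun_prop))
        fun a b c => by rw [← Completion.coe_add, ← cm, ← cm, ← cm, ← Completion.coe_add, mul_add]
    right_distrib := fun a b c =>
      Completion.induction_on₃ a b c
        (isClosed_eq (by fun_prop) (by fun_prop))
        fun a b c => by rw [← Completion.coe_add, ← cm, ← cm, ← cm, ← Completion.coe_add, add_mul]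
    norm_mul_le := fun a b =>
      Completion.induction_on₂ a b (isClosed_le (by fun_prop) (by fun_prop))
        fun a b => by simpa only [← cm, norm_coe] using norm_mul_le a b }

end Completion

variable {𝕜 : Type w} [RCLike 𝕜] {G : Type u} [Group G] [TopologicalSpace G]
  [IsTopologicalGroup G] [LocallyCompactSpace G] [MeasurableSpace G] [BorelSpace G]

section Seminorm

variable (μ : Measure G) [μ.IsHaarMeasure] (𝓗 : Set (HilbertSpace.{w, v} 𝕜))

variable (G) in
/-- The class `𝓡` of all unitary strongly continuous representations of `G` in the Hilbert spaces
from the class `𝓗`. -/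
abbrev UnitaryReps : Type _ := (X : 𝓗) × UnitaryRep G X.1

theorem bddAbove_norm (f : ConvAlg 𝕜 G μ) :
    BddAbove (range fun U : UnitaryReps G 𝓗 => ‖U.2.integratedForm f‖) :=
  ⟨f.l1norm, by rintro _ ⟨U, rfl⟩; exact U.2.norm_integratedForm_le f⟩

/-- The seminorm `σ(f) = sup ‖U(f)‖` on `C_c(G)`, where the supremum is over the class `𝓡` of all
unitary strongly continuous representations `U` of `G` in the spaces from `𝓗`. -/
noncomputable def sigma : Seminorm 𝕜 (ConvAlg 𝕜 G μ) :=
  Seminorm.of (fun f => ⨆ U : UnitaryReps G 𝓗, ‖U.2.integratedForm f‖)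
    (fun f g => Real.iSup_le
      (fun U => by
        rw [_root_.map_add]
        exact (norm_add_le _ _).trans (add_le_add (le_ciSup (bddAbove_norm μ 𝓗 f) U)
          (le_ciSup (bddAbove_norm μ 𝓗 g) U)))
      (add_nonneg (Real.iSup_nonneg fun _ => norm_nonneg _)
        (Real.iSup_nonneg fun _ => norm_nonneg _)))
    (fun c f => by
      simp only [_root_.map_smul, norm_smul]
      exact (Real.mul_iSup_of_nonneg (norm_nonneg c) _).symm)

theorem sigma_apply (f : ConvAlg 𝕜 G μ) :
    sigma μ 𝓗 f = ⨆ U : UnitaryReps G 𝓗, ‖U.2.integratedForm f‖ := rfl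

theorem norm_le_sigma (U : UnitaryReps G 𝓗) (f : ConvAlg 𝕜 G μ) :
    ‖U.2.integratedForm f‖ ≤ sigma μ 𝓗 f :=
  le_ciSup (bddAbove_norm μ 𝓗 f) U

theorem sigma_mul_le (f g : ConvAlg 𝕜 G μ) : sigma μ 𝓗 (f * g) ≤ sigma μ 𝓗 f * sigma μ 𝓗 g :=
  Real.iSup_le
    (fun U => by
      rw [_root_.map_mul]
      exact (norm_mul_le _ _).trans (mul_le_mul (norm_le_sigma μ 𝓗 U f) (norm_le_sigma μ 𝓗 U g)
        (norm_nonneg _) (apply_nonneg _ _)))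
    (mul_nonneg (apply_nonneg _ _) (apply_nonneg _ _))

theorem sigma_star (f : ConvAlg 𝕜 G μ) : sigma μ 𝓗 (star f) = sigma μ 𝓗 f := by
  have h : ∀ U : UnitaryReps G 𝓗, ‖U.2.integratedForm (star f)‖ = ‖U.2.integratedForm f‖ := by
    intro U
    rw [map_star]
    exact norm_star (U.2.integratedForm f)
  simp only [sigma_apply, h]

theorem sigma_mul_self_le (f : ConvAlg 𝕜 G μ) :
    sigma μ 𝓗 f * sigma μ 𝓗 f ≤ sigma μ 𝓗 (star f * f) := by
  have h : sigma μ 𝓗 f ≤ Real.sqrt (sigma μ 𝓗 (star f * f)) := by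
    refine Real.iSup_le (fun U => ?_) (Real.sqrt_nonneg _)
    refine Real.le_sqrt_of_sq_le ?_
    refine le_trans (le_of_eq ?_) (norm_le_sigma μ 𝓗 U (star f * f))
    rw [_root_.map_mul, map_star, sq]
    exact CStarRing.norm_star_mul_self.symm
  have h0 : 0 ≤ sigma μ 𝓗 f := apply_nonneg _ _
  calc sigma μ 𝓗 f * sigma μ 𝓗 f
      ≤ Real.sqrt (sigma μ 𝓗 (star f * f)) * Real.sqrt (sigma μ 𝓗 (star f * f)) :=
        mul_le_mul h h h0 (Real.sqrt_nonneg _)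
    _ = _ := Real.mul_self_sqrt (apply_nonneg _ _)

/-- The algebra `C_c(G)`, seminormed by `σ`. -/
def PreCrossedProduct (μ : Measure G) (_𝓗 : Set (HilbertSpace.{w, v} 𝕜)) : Type _ := ConvAlg 𝕜 G μ

end Seminorm

namespace PreCrossedProduct

variable {μ : Measure G} [μ.IsHaarMeasure] {𝓗 : Set (HilbertSpace.{w, v} 𝕜)}

noncomputable instance : NonUnitalRing (PreCrossedProduct μ 𝓗) :=
  inferInstanceAs (NonUnitalRing (ConvAlg 𝕜 G μ))

noncomputable instance : Module 𝕜 (PreCrossedProduct μ 𝓗) :=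
  inferInstanceAs (Module 𝕜 (ConvAlg 𝕜 G μ))

noncomputable instance : StarRing (PreCrossedProduct μ 𝓗) :=
  inferInstanceAs (StarRing (ConvAlg 𝕜 G μ))

instance : StarModule 𝕜 (PreCrossedProduct μ 𝓗) :=
  inferInstanceAs (StarModule 𝕜 (ConvAlg 𝕜 G μ))

instance : IsScalarTower 𝕜 (PreCrossedProduct μ 𝓗) (PreCrossedProduct μ 𝓗) :=
  inferInstanceAs (IsScalarTower 𝕜 (ConvAlg 𝕜 G μ) (ConvAlg 𝕜 G μ))

instance : SMulCommClass 𝕜 (PreCrossedProduct μ 𝓗) (PreCrossedProduct μ 𝓗) :=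
  inferInstanceAs (SMulCommClass 𝕜 (ConvAlg 𝕜 G μ) (ConvAlg 𝕜 G μ))

noncomputable instance : NonUnitalSeminormedRing (PreCrossedProduct μ 𝓗) :=
  { (inferInstance : NonUnitalRing (PreCrossedProduct μ 𝓗)),
    (sigma μ 𝓗).toAddGroupSeminorm.toSeminormedAddCommGroup.toPseudoMetricSpace with
    norm := sigma (𝕜 := 𝕜) μ 𝓗
    dist_eq := (sigma μ 𝓗).toAddGroupSeminorm.toSeminormedAddCommGroup.dist_eq
    norm_mul_le := sigma_mul_le μ 𝓗 }

theorem norm_def (f : PreCrossedProduct μ 𝓗) : ‖f‖ = sigma (𝕜 := 𝕜) μ 𝓗 f := rfl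

noncomputable instance : NormedSpace 𝕜 (PreCrossedProduct μ 𝓗) where
  __ := (inferInstance : Module 𝕜 (PreCrossedProduct μ 𝓗))
  norm_smul_le c f := (map_smul_eq_mul (sigma μ 𝓗) c f).le

instance : NormedStarGroup (PreCrossedProduct μ 𝓗) where
  norm_star_le f := (sigma_star μ 𝓗 f).le

end PreCrossedProduct

/-- The crossed product `(𝕜 ⋊ G)^𝓡`: the completion of `C_c(G) / ker σ` in the norm induced by `σ`
(the Hausdorff completion of `C_c(G)` for the seminorm `σ`). -/
def CrossedProduct (μ : Measure G) [μ.IsHaarMeasure] (𝓗 : Set (HilbertSpace.{w, v} 𝕜)) : Type _ :=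
  UniformSpace.Completion (PreCrossedProduct μ 𝓗)

namespace CrossedProduct

open UniformSpace

variable {μ : Measure G} [μ.IsHaarMeasure] {𝓗 : Set (HilbertSpace.{w, v} 𝕜)}

noncomputable instance : NonUnitalNormedRing (CrossedProduct μ 𝓗) :=
  completionNonUnitalNormedRing (PreCrossedProduct μ 𝓗)

noncomputable instance : NormedSpace 𝕜 (CrossedProduct μ 𝓗) :=
  inferInstanceAs (NormedSpace 𝕜 (Completion (PreCrossedProduct μ 𝓗)))

instance : CompleteSpace (CrossedProduct μ 𝓗) :=
  inferInstanceAs (CompleteSpace (Completion (PreCrossedProduct μ 𝓗)))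

/-- The canonical map from `C_c(G)` into the crossed product. -/
noncomputable def ofFun (f : ConvAlg 𝕜 G μ) : CrossedProduct μ 𝓗 :=
  Completion.coe' (show PreCrossedProduct μ 𝓗 from f)

theorem induction_on {p : CrossedProduct μ 𝓗 → Prop} (a : CrossedProduct μ 𝓗)
    (hp : IsClosed {a | p a}) (ih : ∀ f, p (ofFun f)) : p a :=
  Completion.induction_on a hp ih

theorem ofFun_add (f g : ConvAlg 𝕜 G μ) :
    (ofFun (f + g) : CrossedProduct μ 𝓗) = ofFun f + ofFun g :=
  Completion.coe_add (α := PreCrossedProduct μ 𝓗) f g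

theorem ofFun_smul (c : 𝕜) (f : ConvAlg 𝕜 G μ) :
    (ofFun (c • f) : CrossedProduct μ 𝓗) = c • ofFun f :=
  Completion.coe_smul (X := PreCrossedProduct μ 𝓗) c f

theorem ofFun_mul (f g : ConvAlg 𝕜 G μ) :
    (ofFun (f * g) : CrossedProduct μ 𝓗) = ofFun f * ofFun g :=
  completion_coe_mul (PreCrossedProduct μ 𝓗) f g

theorem norm_ofFun (f : ConvAlg 𝕜 G μ) :
    ‖(ofFun f : CrossedProduct μ 𝓗)‖ = sigma μ 𝓗 f :=
  Completion.norm_coe (E := PreCrossedProduct μ 𝓗) f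

/-- The involution of the crossed product: the continuous extension of that of `C_c(G)`. -/
noncomputable instance : Star (CrossedProduct μ 𝓗) where
  star := Completion.map (star : PreCrossedProduct μ 𝓗 → PreCrossedProduct μ 𝓗)

theorem star_ofFun (f : ConvAlg 𝕜 G μ) :
    star (ofFun f : CrossedProduct μ 𝓗) = ofFun (star f) :=
  Completion.map_coe (star_isometry (E := PreCrossedProduct μ 𝓗)).uniformContinuous f

theorem continuous_star' : Continuous (star : CrossedProduct μ 𝓗 → CrossedProduct μ 𝓗) :=
  Completion.continuous_map

instance : IsScalarTower 𝕜 (CrossedProduct μ 𝓗) (CrossedProduct μ 𝓗) where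
  smul_assoc c a b := by
    simp only [smul_eq_mul]
    induction a using CrossedProduct.induction_on with
    | hp => exact isClosed_eq ((continuous_const_smul c).mul continuous_const) ((continuous_id.mul continuous_const).const_smul c)
    | ih f => ?_
    induction b using CrossedProduct.induction_on with
    | hp => exact isClosed_eq (continuous_const.mul continuous_id) ((continuous_const.mul continuous_id).const_smul c)
    | ih g => ?_
    rw [← ofFun_smul, ← ofFun_mul, ← ofFun_mul, ← ofFun_smul, smul_mul_assoc]

instance : SMulCommClass 𝕜 (CrossedProduct μ 𝓗) (CrossedProduct μ 𝓗) where
  smul_comm c a b := by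
    simp only [smul_eq_mul]
    induction a using CrossedProduct.induction_on with
    | hp => exact isClosed_eq ((continuous_id.mul continuous_const).const_smul c) (continuous_id.mul continuous_const)
    | ih f => ?_
    induction b using CrossedProduct.induction_on with
    | hp => exact isClosed_eq ((continuous_const.mul continuous_id).const_smul c) (continuous_const.mul (continuous_const_smul c))
    | ih g => ?_
    rw [← ofFun_smul, ← ofFun_mul, ← ofFun_mul, ← ofFun_smul, mul_smul_comm]

noncomputable instance : StarRing (CrossedProduct μ 𝓗) where
  star_involutive a := by
    have h := continuous_star' (μ := μ) (𝓗 := 𝓗)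
    induction a using CrossedProduct.induction_on with
    | hp => exact isClosed_eq (h.comp h) continuous_id
    | ih f => ?_
    rw [star_ofFun, star_ofFun, star_star]
  star_add a b := by
    have h := continuous_star' (μ := μ) (𝓗 := 𝓗)
    induction a using CrossedProduct.induction_on with
    | hp => exact isClosed_eq (by fun_prop) (by fun_prop)
    | ih f => ?_
    induction b using CrossedProduct.induction_on with
    | hp => exact isClosed_eq (by fun_prop) (by fun_prop)
    | ih g => ?_
    rw [← ofFun_add, star_ofFun, star_ofFun, star_ofFun, ← ofFun_add, star_add]
  star_mul a b := by
    have h := continuous_star' (μ := μ) (𝓗 := 𝓗)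
    induction a using CrossedProduct.induction_on with
    | hp => exact isClosed_eq (by fun_prop) (by fun_prop)
    | ih f => ?_
    induction b using CrossedProduct.induction_on with
    | hp => exact isClosed_eq (by fun_prop) (by fun_prop)
    | ih g => ?_
    rw [← ofFun_mul, star_ofFun, star_ofFun, star_ofFun, ← ofFun_mul, star_mul]

instance : StarModule 𝕜 (CrossedProduct μ 𝓗) where
  star_smul c a := by
    have h := continuous_star' (μ := μ) (𝓗 := 𝓗)
    induction a using CrossedProduct.induction_on with
    | hp => exact isClosed_eq (h.comp (continuous_const_smul c)) ((continuous_const_smul (star c)).comp h)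
    | ih f => ?_
    rw [← ofFun_smul, star_ofFun, star_ofFun, ← ofFun_smul, star_smul]

instance : CStarRing (CrossedProduct μ 𝓗) where
  norm_mul_self_le a := by
    have h := continuous_star' (μ := μ) (𝓗 := 𝓗)
    induction a using CrossedProduct.induction_on with
    | hp => exact isClosed_le (by fun_prop) (by fun_prop)
    | ih f => ?_
    rw [star_ofFun, ← ofFun_mul, norm_ofFun, norm_ofFun]
    exact sigma_mul_self_le μ 𝓗 f

/-- For complex scalars, the crossed product is a C⋆-algebra. -/
noncomputable instance {𝓗 : Set (HilbertSpace.{0, v} ℂ)} :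
    NonUnitalCStarAlgebra (CrossedProduct μ 𝓗) where

variable (μ 𝓗) in
/-- The canonical map `q` from `C_c(G)` into the crossed product, as a homomorphism of involutive
algebras. -/
noncomputable def q : ConvAlg 𝕜 G μ →⋆ₙₐ[𝕜] CrossedProduct μ 𝓗 where
  toFun := ofFun
  map_smul' := ofFun_smul
  map_zero' := Completion.coe_zero (α := PreCrossedProduct μ 𝓗)
  map_add' := ofFun_add
  map_mul' := ofFun_mul
  map_star' f := (star_ofFun f).symm

theorem norm_q (f : ConvAlg 𝕜 G μ) : ‖q μ 𝓗 f‖ = sigma μ 𝓗 f := norm_ofFun f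

theorem denseRange_q : DenseRange (q μ 𝓗) :=
  Completion.denseRange_coe (α := PreCrossedProduct μ 𝓗)

end CrossedProduct

namespace UnitaryRep

open UniformSpace

variable {μ : Measure G} [μ.IsHaarMeasure] {𝓗 : Set (HilbertSpace.{w, v} 𝕜)} {X : 𝓗}

/-- The extension of the integrated form of `U` to the crossed product, as a function. -/
noncomputable def crossedRepFun (U : UnitaryRep G X.1) :
    CrossedProduct μ 𝓗 → (X.1 →L[𝕜] X.1) :=
  Completion.extension (α := PreCrossedProduct μ 𝓗) U.integratedForm

theorem crossedRepFun_uniformContinuous (U : UnitaryRep G X.1) :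
    UniformContinuous (α := PreCrossedProduct μ 𝓗) U.integratedForm := by
  refine (LipschitzWith.of_dist_le_mul (K := 1) fun f g => ?_).uniformContinuous
  rw [dist_eq_norm, dist_eq_norm, NNReal.coe_one, one_mul]
  have h := norm_le_sigma μ 𝓗 ⟨X, U⟩ (f - g : PreCrossedProduct μ 𝓗)
  rw [← PreCrossedProduct.norm_def] at h
  refine le_trans (le_of_eq ?_) h
  congr 1
  exact (_root_.map_sub (U.integratedForm (μ := μ)) f g).symm

theorem crossedRepFun_q (U : UnitaryRep G X.1) (f : ConvAlg 𝕜 G μ) :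
    U.crossedRepFun (CrossedProduct.q μ 𝓗 f) = U.integratedForm f :=
  Completion.extension_coe (α := PreCrossedProduct μ 𝓗) U.crossedRepFun_uniformContinuous f

theorem crossedRepFun_continuous (U : UnitaryRep G X.1) :
    Continuous (U.crossedRepFun : CrossedProduct μ 𝓗 → _) :=
  Completion.continuous_extension

/-- The involutive representation `U^𝓡` of the crossed product associated with a unitary strongly
continuous representation `U` of `G` in a space from `𝓗`. It is the continuous extension of the
integrated form, so that `U^𝓡(q(f)) = ∫ f s • U s ds`. -/
noncomputable def crossedRep (U : UnitaryRep G X.1) :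
    CrossedProduct μ 𝓗 →⋆ₙₐ[𝕜] (X.1 →L[𝕜] X.1) where
  toFun := U.crossedRepFun
  map_zero' := by
    rw [← _root_.map_zero (CrossedProduct.q μ 𝓗), crossedRepFun_q, _root_.map_zero]
  map_smul' c a := by
    have h := U.crossedRepFun_continuous (μ := μ)
    induction a using CrossedProduct.induction_on with
    | hp => exact isClosed_eq (h.comp (continuous_const_smul c)) (h.const_smul c)
    | ih f => ?_
    · change U.crossedRepFun (c • CrossedProduct.q μ 𝓗 f) = c • U.crossedRepFun
        (CrossedProduct.q μ 𝓗 f)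
      rw [← _root_.map_smul, crossedRepFun_q, crossedRepFun_q, _root_.map_smul]
  map_add' a b := by
    have h := U.crossedRepFun_continuous (μ := μ)
    induction a using CrossedProduct.induction_on with
    | hp => exact isClosed_eq (by fun_prop) (by fun_prop)
    | ih f => ?_
    induction b using CrossedProduct.induction_on with
    | hp => exact isClosed_eq (by fun_prop) (by fun_prop)
    | ih g => ?_
    change U.crossedRepFun (CrossedProduct.q μ 𝓗 f + CrossedProduct.q μ 𝓗 g) =
      U.crossedRepFun (CrossedProduct.q μ 𝓗 f) + U.crossedRepFun (CrossedProduct.q μ 𝓗 g)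
    rw [← _root_.map_add, crossedRepFun_q, crossedRepFun_q, crossedRepFun_q, _root_.map_add]
  map_mul' a b := by
    have h := U.crossedRepFun_continuous (μ := μ)
    induction a using CrossedProduct.induction_on with
    | hp => exact isClosed_eq (by fun_prop) (by fun_prop)
    | ih f => ?_
    induction b using CrossedProduct.induction_on with
    | hp => exact isClosed_eq (by fun_prop) (by fun_prop)
    | ih g => ?_
    change U.crossedRepFun (CrossedProduct.q μ 𝓗 f * CrossedProduct.q μ 𝓗 g) =
      U.crossedRepFun (CrossedProduct.q μ 𝓗 f) * U.crossedRepFun (CrossedProduct.q μ 𝓗 g)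
    rw [← _root_.map_mul, crossedRepFun_q, crossedRepFun_q, crossedRepFun_q, _root_.map_mul]
  map_star' a := by
    have h := U.crossedRepFun_continuous (μ := μ)
    have h' := CrossedProduct.continuous_star' (μ := μ) (𝓗 := 𝓗)
    induction a using CrossedProduct.induction_on with
    | hp => exact isClosed_eq (by fun_prop) (by fun_prop)
    | ih f => ?_
    change U.crossedRepFun (star (CrossedProduct.q μ 𝓗 f)) =
      star (U.crossedRepFun (CrossedProduct.q μ 𝓗 f))
    rw [← map_star, crossedRepFun_q, crossedRepFun_q, map_star]

theorem crossedRep_q (U : UnitaryRep G X.1) (f : ConvAlg 𝕜 G μ) :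
    U.crossedRep (CrossedProduct.q μ 𝓗 f) = U.integratedForm f :=
  U.crossedRepFun_q f

end UnitaryRep

section Predicates

/-- A representation `T` of an algebra `A` on `X` is non-degenerate if the linear span of all
`T a x` is dense in `X`. -/
def IsNondegenerate {A : Type*} [NonUnitalNonAssocSemiring A] [DistribMulAction 𝕜 A] [Star A]
    {X : HilbertSpace.{w, v} 𝕜} (T : A →⋆ₙₐ[𝕜] (X →L[𝕜] X)) : Prop :=
  Dense (Submodule.span 𝕜 {y : X | ∃ a x, T a x = y} : Set X)

/-- The closed subspaces of `X` that are invariant under all members of a family of operators. -/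
def closedInvariantSubspaces {ι : Type*} {X : HilbertSpace.{w, v} 𝕜} (S : ι → (X →L[𝕜] X)) :
    Set (Submodule 𝕜 X) :=
  {Z | IsClosed (Z : Set X) ∧ ∀ i, ∀ x ∈ Z, S i x ∈ Z}

/-- The space of bounded intertwining operators `Φ : X → Y` between two families of operators on
`X` and `Y`, as a subspace of the Banach space of all bounded operators from `X` to `Y`. -/
def intertwiners {ι : Type*} {X Y : HilbertSpace.{w, v} 𝕜} (S : ι → (X →L[𝕜] X))
    (T : ι → (Y →L[𝕜] Y)) : Submodule 𝕜 (X →L[𝕜] Y) where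
  carrier := {Φ | ∀ i, T i ∘L Φ = Φ ∘L S i}
  zero_mem' := by intro i; simp
  add_mem' := by intro Φ Ψ hΦ hΨ i; simp [hΦ i, hΨ i]
  smul_mem' := by intro c Φ hΦ i; simp [hΦ i]

/-- The set of all numbers `‖π f‖`, where `π` runs over the non-degenerate involutive
representations of the convolution algebra `C_c(G)` in Hilbert spaces (of universe level `v`) that
are contractive for the `L¹`-norm, i.e. over the non-degenerate involutive representations of
`L¹(G)`. The norm of the group C⋆-algebra `C⋆(G)` is the supremum of this set. -/
def groupCStarNorms {μ : Measure G} [μ.IsHaarMeasure] (f : ConvAlg 𝕜 G μ) : Set ℝ :=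
  {c | ∃ (X : HilbertSpace.{w, v} 𝕜) (π : ConvAlg 𝕜 G μ →⋆ₙₐ[𝕜] (X →L[𝕜] X)),
    IsNondegenerate π ∧ (∀ g, ‖π g‖ ≤ g.l1norm) ∧ ‖π f‖ = c}

end Predicates

end GroupCrossed

open GroupCrossed MeasureTheory

namespace GroupCrossed

open MeasureTheory Measure Set Topology
open scoped CompactlySupported Pointwise

/-! Two constructions are inverse to each other: integration takes a unitary representation of `G`
to a non-degenerate `L¹`-contractive representation of `C_c(G)`, and disintegration goes back. The
crossed product enters only by continuity and density.

Integration loses nothing because a continuous function `h` with `∫ f h = 0` for all `f` in `C_c(G)`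
vanishes (`eq_zero_of_forall_integral_mul_eq_zero`). Applied to matrix coefficients `s ↦ ⟪y, U s
x⟫`, this yields injectivity, non-degeneracy, and the equality of invariant subspaces and of
intertwiners for `U` and its integrated form.

For disintegration, let `π` be non-degenerate and `L¹`-contractive, and let `λ_s` be left
translation. Left invariance gives `(λ_s f)⋆ * (λ_s g) = f⋆ * g`, so `∑ π(f_i) x_i ↦ ∑ π(λ_s f_i)
x_i` preserves inner products. It therefore extends from a dense subspace to an isometry `U s`, and
these operators form a strongly continuous unitary representation. The formula `π(f * g) x = ∫ f(r)
π(λ_r g) x dr` (`starHom_mul_eq_integral`) then says that `U(f)` and `π(f)` agree on the dense span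
of the vectors `π(g) x`.

A representation of the crossed product gives such a `π` by composition with `q`: every involutive
representation of a Banach algebra with isometric involution is contractive (`norm_starHom_le`), and
`σ` is at most the `L¹`-norm. The same correspondence on `C_c(G)` identifies the norm of the crossed
product with that of `C⋆(G)`. -/

theorem starHom_inner_star {𝕜 : Type*} [RCLike 𝕜] {A : Type*} [NonUnitalNonAssocSemiring A]
    [DistribMulAction 𝕜 A] [Star A] {H : Type*} [NormedAddCommGroup H] [InnerProductSpace 𝕜 H]
    [CompleteSpace H] (T : A →⋆ₙₐ[𝕜] (H →L[𝕜] H)) (a : A) (x y : H) :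
    inner 𝕜 (T (star a) x) y = inner 𝕜 x (T a y) := by
  rw [map_star, ContinuousLinearMap.star_eq_adjoint, ContinuousLinearMap.adjoint_inner_left]

/-! ### Automatic contractivity of involutive representations, over real or complex scalars. -/

section Contractive

variable {A : Type*} [NonUnitalNormedRing A] [CompleteSpace A] [StarRing A] [NormedStarGroup A]

/-- The equation is `(1 - k)² = 1 - h` written without a unit, so `1 - k` is a square root of `1 -
h`. It is solved as the fixed point `k = (h + k²) / 2`, an argument that needs neither spectral
theory nor complex scalars. -/
theorem exists_isSelfAdjoint_add_self_sub_mul_self (𝕜 : Type*) [RCLike 𝕜] [NormedSpace 𝕜 A]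
    [StarModule 𝕜 A] {h : A} (hh : IsSelfAdjoint h)
    (h1 : ‖h‖ < 1) : ∃ k : A, IsSelfAdjoint k ∧ k + k - k * k = h := by
  -- On the ball of radius `‖h‖`, `φ` has norm at most `(‖h‖ + ‖h‖²) / 2 ≤ ‖h‖` and Lipschitz
  -- constant `‖h‖ < 1`. Keeping only self-adjoint elements makes the limit self-adjoint.
  let s : Set A := {k | IsSelfAdjoint k} ∩ Metric.closedBall 0 ‖h‖
  let φ : A → A := fun k => (2⁻¹ : 𝕜) • (h + k * k)
  have n2 : ‖(2⁻¹ : 𝕜)‖ = 2⁻¹ := by simp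
  have hs : IsComplete s := by
    refine IsClosed.isComplete (IsClosed.inter ?_ Metric.isClosed_closedBall)
    exact isClosed_eq continuous_star continuous_id
  have hφ : MapsTo φ s s := by
    rintro k ⟨hk, hk'⟩
    rw [mem_closedBall_zero_iff] at hk'
    refine ⟨?_, ?_⟩
    · change star (φ k) = φ k
      have e1 : star k = k := hk
      have e2 : star h = h := hh
      simp [φ, star_smul, e1, e2]
    · rw [mem_closedBall_zero_iff, norm_smul, n2]
      have a := norm_add_le h (k * k)
      have b := norm_mul_le k k
      nlinarith [norm_nonneg h, norm_nonneg k]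
  have hL : LipschitzWith ‖h‖₊ (hφ.restrict φ s s) := by
    refine LipschitzWith.of_dist_le_mul ?_
    rintro ⟨k, hk, hk'⟩ ⟨l, hl, hl'⟩
    rw [mem_closedBall_zero_iff] at hk' hl'
    change dist (φ k) (φ l) ≤ ‖h‖ * dist k l
    have e : φ k - φ l = (2⁻¹ : 𝕜) • (k * (k - l) + (k - l) * l) := by
      simp only [φ, ← smul_sub]
      congr 1
      noncomm_ring
    rw [dist_eq_norm, dist_eq_norm, e, norm_smul, n2]
    have a := norm_add_le (k * (k - l)) ((k - l) * l)
    have b := norm_mul_le k (k - l)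
    have c := norm_mul_le (k - l) l
    nlinarith [norm_nonneg (k - l)]
  have h0 : (0 : A) ∈ s := ⟨star_zero A, by simp⟩
  obtain ⟨k, hk, hfix, -⟩ := ContractingWith.exists_fixedPoint' (f := φ) (K := ‖h‖₊) hs hφ
    ⟨by exact_mod_cast h1, hL⟩ h0 (edist_ne_top _ _)
  refine ⟨k, hk.1, ?_⟩
  have e : (2⁻¹ : 𝕜) • (h + k * k) = k := hfix
  have : h + k * k = k + k := by
    rw [← two_smul 𝕜 k]
    nth_rw 3 [← e]
    rw [smul_smul, mul_inv_cancel₀ two_ne_zero, one_smul]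
  rw [← this, add_sub_cancel_right]

variable {𝕜 : Type*} [RCLike 𝕜] [NormedSpace 𝕜 A] [StarModule 𝕜 A]
  {H : Type*} [NormedAddCommGroup H] [InnerProductSpace 𝕜 H] [CompleteSpace H]

/-- With `(1 - k)² = 1 - h`, the difference of the two sides is `‖x - T k x‖²`, which is
non-negative. -/
theorem re_inner_starHom_le (T : A →⋆ₙₐ[𝕜] (H →L[𝕜] H)) {h : A} (hh : IsSelfAdjoint h)
    (h1 : ‖h‖ < 1) (x : H) : RCLike.re (inner 𝕜 x (T h x)) ≤ ‖x‖ ^ 2 := by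
  obtain ⟨k, hk, rfl⟩ := exists_isSelfAdjoint_add_self_sub_mul_self 𝕜 hh h1
  have e : inner 𝕜 x (T (k * k) x) = inner 𝕜 (T k x) (T k x) := by
    rw [map_mul, mul_apply_eq_comp, ← starHom_inner_star, hk.star_eq]
  have h2 := norm_sub_sq (𝕜 := 𝕜) x (T k x)
  have h3 : RCLike.re (inner 𝕜 (T k x) (T k x)) = ‖T k x‖ ^ 2 := by
    rw [inner_self_eq_norm_sq_to_K]; norm_cast
  rw [map_sub, map_add]
  simp only [_root_.sub_apply, _root_.add_apply, inner_sub_right, inner_add_right, map_sub, map_add, e, h3]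
  nlinarith [sq_nonneg ‖x - T k x‖]

/-- For `‖b‖ < 1` the element `star b * b` is self-adjoint of norm less than one, and `⟪x, T (star b
* b) x⟫ = ‖T b x‖²`. The general case follows by scaling. -/
theorem norm_starHom_le (T : A →⋆ₙₐ[𝕜] (H →L[𝕜] H)) (a : A) : ‖T a‖ ≤ ‖a‖ := by
  have key : ∀ b : A, ‖b‖ < 1 → ‖T b‖ ≤ 1 := by
    intro b hb
    refine ContinuousLinearMap.opNorm_le_bound _ zero_le_one fun x => ?_
    have h1 : ‖star b * b‖ < 1 := by
      refine (norm_mul_le _ _).trans_lt ?_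
      rw [norm_star]
      nlinarith [norm_nonneg b]
    have h2 := re_inner_starHom_le T (IsSelfAdjoint.star_mul_self b) h1 x
    have h3 : inner 𝕜 x (T (star b * b) x) = inner 𝕜 (T b x) (T b x) := by
      rw [map_mul, ← star_star b, starHom_inner_star, star_star]
      rfl
    rw [h3, inner_self_eq_norm_sq_to_K] at h2
    have h4 : ‖T b x‖ ^ 2 ≤ ‖x‖ ^ 2 := by exact_mod_cast h2
    rw [one_mul]
    exact le_of_sq_le_sq h4 (norm_nonneg x)
  -- The bound is known only on the open unit ball, so `a` is divided by an arbitrary `c > ‖a‖`.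
  refine le_of_forall_gt_imp_ge_of_dense fun c hc => ?_
  have c0 : 0 < c := (norm_nonneg a).trans_lt hc
  have hn : ‖((c : 𝕜)⁻¹)‖ = c⁻¹ := by rw [norm_inv, RCLike.norm_ofReal, abs_of_pos c0]
  have := key ((c : 𝕜)⁻¹ • a) (by
    rw [norm_smul, hn, inv_mul_lt_iff₀ c0, mul_one]; exact hc)
  rwa [map_smul, norm_smul, hn, inv_mul_le_iff₀ c0, mul_one] at this

end Contractive

/-! ### Functions in `C_c(G)` separate continuous functions. -/

section Vanishing

variable {𝕜 : Type*} [RCLike 𝕜] {G : Type*} [Group G] [TopologicalSpace G]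
  [IsTopologicalGroup G] [LocallyCompactSpace G] [MeasurableSpace G] [BorelSpace G]
  (μ : Measure G) [μ.IsHaarMeasure]

theorem eq_zero_of_forall_integral_mul_eq_zero {h : G → 𝕜} (hh : Continuous h)
    (H : ∀ f : ConvAlg 𝕜 G μ, ∫ s, f s * h s ∂μ = 0) (s : G) : h s = 0 := by
  by_contra hs
  obtain ⟨⟨b, b_cont⟩, b_comp, b_nonneg, b_one⟩ :
    ∃ f : C(G, ℝ), HasCompactSupport f ∧ 0 ≤ f ∧ f s ≠ 0 := exists_continuous_nonneg_pos s
  change Continuous b at b_cont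
  change HasCompactSupport b at b_comp
  -- With `b ≥ 0` a bump at `s`, the integrand `f h` becomes `b ‖h‖²`, whose integral is positive if
  -- `h s ≠ 0`.
  let f : ConvAlg 𝕜 G μ := ConvAlg.mk (fun t => (b t : 𝕜) * star (h t))
    ((RCLike.continuous_ofReal.comp b_cont).mul hh.star)
    (HasCompactSupport.mul_right (b_comp.comp_left (g := fun x : ℝ => (x : 𝕜)) (by simp)))
  have h1 : ∀ t, f t * h t = ((b t * ‖h t‖ ^ 2 : ℝ) : 𝕜) := by
    intro t
    simp only [f, ConvAlg.mk_apply, RCLike.star_def, mul_assoc, RCLike.conj_mul]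
    norm_cast
  have h2 := H f
  simp_rw [h1] at h2
  rw [integral_ofReal, RCLike.ofReal_eq_zero] at h2
  refine absurd h2 (ne_of_gt ?_)
  refine Continuous.integral_pos_of_hasCompactSupport_nonneg_nonzero (x := s)
    (b_cont.mul (hh.norm.pow 2)) (HasCompactSupport.mul_right b_comp)
    (fun t => mul_nonneg (b_nonneg t) (sq_nonneg _)) ?_
  exact mul_ne_zero b_one (pow_ne_zero _ (norm_ne_zero_iff.2 hs))

end Vanishing

/-! ### Left translation on `C_c(G)` and its `L¹`-estimates. -/

namespace ConvAlg

section Translate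

variable {𝕜 : Type*} [RCLike 𝕜] {G : Type*} [Group G] [TopologicalSpace G] [IsTopologicalGroup G]
  [MeasurableSpace G] {μ : Measure G}

theorem sub_apply (f g : ConvAlg 𝕜 G μ) (s : G) : (f - g) s = f s - g s := rfl

/-- Left translation `(λ_s f) r = f (s⁻¹ * r)` on `C_c(G)`. -/
def translate (s : G) : ConvAlg 𝕜 G μ →ₗ[𝕜] ConvAlg 𝕜 G μ where
  toFun f := mk (fun r => f (s⁻¹ * r)) (by fun_prop)
    (f.hasCompactSupport.comp_homeomorph (Homeomorph.mulLeft s⁻¹))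
  map_add' _ _ := rfl
  map_smul' _ _ := rfl

@[simp] theorem translate_apply (s : G) (f : ConvAlg 𝕜 G μ) (r : G) :
    translate s f r = f (s⁻¹ * r) := rfl

theorem translate_one (f : ConvAlg 𝕜 G μ) : translate 1 f = f := by
  ext r
  simp

theorem translate_mul (s t : G) (f : ConvAlg 𝕜 G μ) :
    translate (s * t) f = translate s (translate t f) := by
  ext r
  simp [mul_assoc]

variable [LocallyCompactSpace G] [BorelSpace G] [μ.IsHaarMeasure]

/-- The substitution `r ↦ r⁻¹` absorbs the modular function of the involution, leaving an integral
to which left invariance applies directly. -/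
theorem star_mul_apply (f g : ConvAlg 𝕜 G μ) (t : G) :
    (star f * g) t = ∫ r, star (f r) * g (r * t) ∂μ := by
  rw [mul_apply, ← integral_modularFunction_inv μ (f := fun r => star (f r) * g (r * t))
    (by fun_prop) (HasCompactSupport.mul_right (f.hasCompactSupport.comp_left (star_zero 𝕜)))]
  congr 1
  ext r
  rw [star_apply, mul_assoc, RCLike.real_smul_eq_coe_mul]

/-- This identity is what makes the operators `π f x ↦ π (λ_s f) x` isometric. -/
theorem star_translate_mul_translate (s : G) (f g : ConvAlg 𝕜 G μ) :
    star (translate s f) * translate s g = star f * g := by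
  ext t
  rw [star_mul_apply, star_mul_apply,
    ← integral_mul_left_eq_self (fun r => star (f r) * g (r * t)) s⁻¹]
  simp [mul_assoc]

theorem continuous_l1norm_translate_sub (f : ConvAlg 𝕜 G μ) (t : G) :
    Continuous fun s => (translate s f - translate t f).l1norm := by
  refine continuous_iff_continuousAt.2 fun s₀ => ?_
  obtain ⟨K, hK, hs₀⟩ := exists_compact_mem_nhds s₀
  refine ContinuousOn.continuousAt (s := K) ?_ hs₀
  -- For all `s` in `K`, the translates by `s` and by `t` are supported in this one compact set.
  refine continuousOn_integral_of_compact_support (k := (insert t K) * tsupport f)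
    ((hK.insert t).mul f.hasCompactSupport.isCompact) ?_ ?_
  · have : Continuous fun p : G × G => ‖f (p.1⁻¹ * p.2) - f (t⁻¹ * p.2)‖ := by fun_prop
    exact this.continuousOn
  · intro s r hs hr
    have h : ∀ a ∈ insert t K, f (a⁻¹ * r) = 0 := by
      intro a ha
      by_contra hne
      exact hr ⟨a, ha, _, subset_tsupport _ hne, by simp⟩
    simp [sub_apply, h s (mem_insert_of_mem _ hs), h t (mem_insert _ _)]

/-- Since `f * g` is the average of the translates `λ_r g` with weight `f(r)`, replacing all of them
by `λ_t g` costs at most `ε` per unit of `L¹`-mass of `f`. Fubini turns the pointwise estimate into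
this one. -/
theorem l1norm_mul_sub_le (f g : ConvAlg 𝕜 G μ) (t : G) {ε : ℝ}
    (h : ∀ r, f r ≠ 0 → (translate r g - translate t g).l1norm ≤ ε) :
    (f * g - (∫ r, f r ∂μ) • translate t g).l1norm ≤ ε * f.l1norm := by
  let D : G → G → ℝ := fun s r => ‖f r‖ * ‖g (r⁻¹ * s) - g (t⁻¹ * s)‖
  have hD : Continuous fun p : G × G => D p.1 p.2 := by fun_prop
  let K : Set G := insert t (tsupport f) * tsupport g
  have hK : IsCompact K := (f.hasCompactSupport.isCompact.insert t).mul g.hasCompactSupport.isCompact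
  have hsupp : ∀ s r, D s r ≠ 0 → s ∈ K ∧ r ∈ tsupport f := by
    intro s r hne
    have hr : r ∈ tsupport f := subset_tsupport f (norm_ne_zero_iff.1 (left_ne_zero_of_mul hne))
    refine ⟨?_, hr⟩
    by_contra hs
    have h : ∀ a ∈ insert t (tsupport f), g (a⁻¹ * s) = 0 := by
      intro a ha
      by_contra hne
      exact hs ⟨a, ha, _, subset_tsupport _ hne, by simp⟩
    exact hne (by simp [D, h r (mem_insert_of_mem _ hr), h t (mem_insert _ _)])
  have hI : Continuous fun s => ∫ r, D s r ∂μ := by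
    rw [← continuousOn_univ]
    refine continuousOn_integral_of_compact_support f.hasCompactSupport.isCompact hD.continuousOn ?_
    intro s r _ hr
    by_contra hne
    exact hr (hsupp s r hne).2
  have hIc : HasCompactSupport fun s => ∫ r, D s r ∂μ := by
    refine HasCompactSupport.intro hK fun s hs => ?_
    have : ∀ r, D s r = 0 := fun r => by
      by_contra hne
      exact hs (hsupp s r hne).1
    simp [this]
  have hpt : ∀ s, ‖(f * g - (∫ r, f r ∂μ) • translate t g) s‖ ≤ ∫ r, D s r ∂μ := by
    intro s
    have e : (f * g - (∫ r, f r ∂μ) • translate t g) s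
        = ∫ r, f r * (g (r⁻¹ * s) - g (t⁻¹ * s)) ∂μ := by
      simp only [mul_sub]
      rw [integral_sub (f.integrable_mul (by fun_prop)) (f.integrable_mul continuous_const),
        integral_mul_const]
      rfl
    rw [e]
    refine (norm_integral_le_integral_norm _).trans (le_of_eq ?_)
    simp only [norm_mul, D]
  calc (f * g - (∫ r, f r ∂μ) • translate t g).l1norm
      ≤ ∫ s, ∫ r, D s r ∂μ ∂μ :=
        integral_mono_of_nonneg (.of_forall fun _ => norm_nonneg _)
          (hI.integrable_of_hasCompactSupport hIc) (.of_forall hpt)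
    _ = ∫ r, ∫ s, D s r ∂μ ∂μ := swap_integral μ hK f.hasCompactSupport.isCompact hD hsupp
    _ = ∫ r, ‖f r‖ * (translate r g - translate t g).l1norm ∂μ := by
        congr 1
        ext r
        exact integral_const_mul _ _
    _ ≤ ∫ r, ε * ‖f r‖ ∂μ := by
        refine integral_mono_of_nonneg
          (.of_forall fun r => mul_nonneg (norm_nonneg _) (integral_nonneg fun _ => norm_nonneg _))
          ((f.continuous.norm.integrable_of_hasCompactSupport f.hasCompactSupport.norm).const_mul ε)
          (.of_forall fun r => ?_)
        by_cases hr : f r = 0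
        · simp [hr]
        · have := mul_le_mul_of_nonneg_left (h r hr) (norm_nonneg (f r))
          rwa [mul_comm _ ε] at this
    _ = ε * f.l1norm := integral_const_mul _ _

/-- A partition of unity on the support of `f`. As its weights are non-negative with sum one there,
the `L¹`-norms of the pieces add up exactly, so errors proportional to them do not grow with the
number of pieces. -/
theorem exists_sum_eq_of_isOpen_cover [T2Space G] (f : ConvAlg 𝕜 G μ) {V : G → Set G}
    (hV : ∀ t, IsOpen (V t)) (hmem : ∀ t, t ∈ V t) :
    ∃ (n : ℕ) (t : Fin n → G) (F : Fin n → ConvAlg 𝕜 G μ), ∑ i, F i = f ∧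
      ∑ i, (F i).l1norm = f.l1norm ∧ ∀ i r, F i r ≠ 0 → r ∈ V (t i) := by
  obtain ⟨T, hT⟩ := f.hasCompactSupport.isCompact.elim_finite_subcover V hV
    fun t _ => mem_iUnion.2 ⟨t, hmem t⟩
  let t : Fin T.card → G := fun i => T.equivFin.symm i
  obtain ⟨φ, hφV, hφ1, hφ01, -⟩ := exists_continuous_sum_one_of_isOpen_isCompact
    (s := fun i => V (t i)) (fun i => hV _) f.hasCompactSupport.isCompact (by
      intro r hr
      obtain ⟨a, ha, hra⟩ := mem_iUnion₂.1 (hT hr)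
      refine mem_iUnion.2 ⟨T.equivFin ⟨a, ha⟩, ?_⟩
      simpa [t] using hra)
  let F : Fin T.card → ConvAlg 𝕜 G μ := fun i => mk (fun r => (φ i r : 𝕜) * f r)
    ((RCLike.continuous_ofReal.comp (φ i).continuous).mul f.continuous)
    f.hasCompactSupport.mul_left
  have hF : ∀ i r, F i r = (φ i r : 𝕜) * f r := fun _ _ => rfl
  have hsum : ∀ r, f r ≠ 0 → ∑ i, φ i r = 1 := by
    intro r hr
    simpa using hφ1 (subset_tsupport f hr)
  refine ⟨T.card, t, F, ?_, ?_, ?_⟩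
  · ext r
    have e : (∑ i, F i) r = ∑ i, F i r :=
      map_sum (AddMonoidHom.mk' (fun h : ConvAlg 𝕜 G μ => h r) fun _ _ => rfl) F Finset.univ
    rw [e]
    simp only [hF]
    rw [← Finset.sum_mul]
    by_cases hr : f r = 0
    · simp [hr]
    · rw [← map_sum (algebraMap ℝ 𝕜), hsum r hr]
      simp
  · unfold l1norm
    rw [← integral_finsetSum _ fun i _ => ((F i).continuous.norm.integrable_of_hasCompactSupport
      (F i).hasCompactSupport.norm)]
    congr 1
    ext r
    have e : ∀ i, ‖F i r‖ = φ i r * ‖f r‖ := by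
      intro i
      rw [hF, norm_mul, RCLike.norm_ofReal, abs_of_nonneg (hφ01 i r).1]
    simp only [e]
    rw [← Finset.sum_mul]
    by_cases hr : f r = 0
    · simp [hr]
    · rw [hsum r hr, one_mul]
  · intro i r hr
    refine hφV i (subset_tsupport _ fun h0 => hr ?_)
    rw [hF, h0]
    simp

end Translate

end ConvAlg

variable {𝕜 : Type w} [RCLike 𝕜] {G : Type u} [Group G] [TopologicalSpace G]
  [IsTopologicalGroup G] [LocallyCompactSpace G] [MeasurableSpace G] [BorelSpace G]

/-! ### Comparison of a unitary representation with its integrated form. -/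

namespace UnitaryRep

variable {μ : Measure G} [μ.IsHaarMeasure] {X Y : HilbertSpace.{w, v} 𝕜}

theorem inner_integratedForm (U : UnitaryRep G X) (f : ConvAlg 𝕜 G μ) (x y : X) :
    inner 𝕜 y (U.integratedForm f x) = ∫ s, f s * inner 𝕜 y (U s x) ∂μ := by
  rw [integratedForm_apply, ← integral_inner (f.integrable_smul (U.continuous_apply x))]
  simp only [inner_smul_right]

theorem continuous_inner_apply (U : UnitaryRep G X) (x y : X) :
    Continuous fun s => inner 𝕜 y (U s x) :=
  continuous_const.inner (U.continuous_apply x)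

theorem inner_apply_eq_zero_iff (μ : Measure G) [μ.IsHaarMeasure] (U : UnitaryRep G X) (x y : X) :
    (∀ f : ConvAlg 𝕜 G μ, inner 𝕜 y (U.integratedForm f x) = 0) ↔
      ∀ s, inner 𝕜 y (U s x) = 0 := by
  refine ⟨fun h s => ?_, fun h f => ?_⟩
  · refine eq_zero_of_forall_integral_mul_eq_zero μ (U.continuous_inner_apply x y) (fun f => ?_) s
    rw [← inner_integratedForm, h]
  · rw [inner_integratedForm]
    simp [h]

/-- A vector `y` orthogonal to the range satisfies `⟪y, U s y⟫ = 0` for all `s`; the case `s = 1`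
gives `y = 0`. -/
theorem isNondegenerate_integratedForm (U : UnitaryRep G X) :
    IsNondegenerate (U.integratedForm (μ := μ)) := by
  rw [IsNondegenerate, Submodule.dense_iff_topologicalClosure_eq_top,
    Submodule.topologicalClosure_eq_top_iff, Submodule.eq_bot_iff]
  intro y hy
  rw [Submodule.mem_orthogonal'] at hy
  have h := (inner_apply_eq_zero_iff μ U y y).1
    (fun f => hy _ (Submodule.subset_span ⟨f, y, rfl⟩)) 1
  rwa [map_one, one_apply_eq_self, inner_self_eq_zero] at h

theorem integratedForm_injective {U V : UnitaryRep G X}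
    (h : ∀ f : ConvAlg 𝕜 G μ, U.integratedForm f = V.integratedForm f) : U = V := by
  ext s x
  refine ext_inner_left 𝕜 fun y => sub_eq_zero.1 ?_
  refine eq_zero_of_forall_integral_mul_eq_zero μ (h := fun s => inner 𝕜 y (U s x) - inner 𝕜 y (V s x))
    ((U.continuous_inner_apply x y).sub (V.continuous_inner_apply x y)) (fun f => ?_) s
  simp only [mul_sub]
  rw [integral_sub (f.integrable_mul (U.continuous_inner_apply x y))
    (f.integrable_mul (V.continuous_inner_apply x y)), ← inner_integratedForm,
    ← inner_integratedForm, h, sub_self]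

theorem closedInvariantSubspaces_integratedForm (μ : Measure G) [μ.IsHaarMeasure]
    (U : UnitaryRep G X) :
    closedInvariantSubspaces (fun f : ConvAlg 𝕜 G μ => U.integratedForm f) =
      closedInvariantSubspaces (fun s : G => U s) := by
  ext Z
  refine and_congr_right fun hZ => ?_
  -- A closed subspace is its own double orthogonal complement, so invariance becomes the vanishing
  -- of matrix coefficients.
  have hmem : ∀ z, z ∈ Z ↔ ∀ y ∈ Zᗮ, inner 𝕜 y z = 0 := by
    intro z
    rw [← Submodule.mem_orthogonal, Submodule.orthogonal_orthogonal_eq_closure,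
      hZ.submodule_topologicalClosure_eq]
  exact ⟨fun h s x hx => (hmem _).2 fun y hy =>
      (inner_apply_eq_zero_iff μ U x y).1 (fun f => (hmem _).1 (h f x hx) y hy) s,
    fun h f x hx => (hmem _).2 fun y hy =>
      (inner_apply_eq_zero_iff μ U x y).2 (fun s => (hmem _).1 (h s x hx) y hy) f⟩

theorem intertwiners_integratedForm (μ : Measure G) [μ.IsHaarMeasure] (U : UnitaryRep G X)
    (V : UnitaryRep G Y) :
    intertwiners (fun f : ConvAlg 𝕜 G μ => U.integratedForm f)
        (fun f : ConvAlg 𝕜 G μ => V.integratedForm f) =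
      intertwiners (fun s : G => U s) (fun s : G => V s) := by
  ext Φ
  change (∀ f : ConvAlg 𝕜 G μ, V.integratedForm f ∘L Φ = Φ ∘L U.integratedForm f) ↔
    ∀ s, V s ∘L Φ = Φ ∘L U s
  have h1 : ∀ (f : ConvAlg 𝕜 G μ) x y, inner 𝕜 y (Φ (U.integratedForm f x)) =
      ∫ s, f s * inner 𝕜 y (Φ (U s x)) ∂μ := by
    intro f x y
    -- Moving `Φ` to the other side as its adjoint leaves an ordinary matrix coefficient of `U`.
    simp only [← ContinuousLinearMap.adjoint_inner_left Φ]
    exact inner_integratedForm U f x _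
  have hc : ∀ x y, Continuous fun s => inner 𝕜 y (Φ (U s x)) := fun x y =>
    continuous_const.inner (Φ.continuous.comp (U.continuous_apply x))
  refine ⟨fun h s => ?_, fun h f => ?_⟩
  · ext x
    refine ext_inner_left 𝕜 fun y => sub_eq_zero.1 ?_
    refine eq_zero_of_forall_integral_mul_eq_zero μ
      (h := fun s => inner 𝕜 y (V s (Φ x)) - inner 𝕜 y (Φ (U s x)))
      ((V.continuous_inner_apply _ y).sub (hc x y)) (fun f => ?_) s
    simp only [mul_sub]
    rw [integral_sub (f.integrable_mul (V.continuous_inner_apply _ y))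
      (f.integrable_mul (hc x y)), ← inner_integratedForm, ← h1, sub_eq_zero]
    exact congrArg _ (DFunLike.congr_fun (h f) x)
  · ext x
    refine ext_inner_left 𝕜 fun y => ?_
    change inner 𝕜 y (V.integratedForm f (Φ x)) = inner 𝕜 y (Φ (U.integratedForm f x))
    rw [inner_integratedForm, h1]
    congr 1
    ext s
    exact congrArg (fun z => f s * inner 𝕜 y z) (DFunLike.congr_fun (h s) x)

end UnitaryRep

/-! ### Representations of the crossed product are determined on the image of `q`. -/

namespace CrossedProduct

variable {μ : Measure G} [μ.IsHaarMeasure] {𝓗 : Set (HilbertSpace.{w, v} 𝕜)}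

theorem sigma_le_l1norm (f : ConvAlg 𝕜 G μ) : sigma μ 𝓗 f ≤ f.l1norm :=
  Real.iSup_le (fun U => U.2.norm_integratedForm_le f) (integral_nonneg fun _ => norm_nonneg _)

theorem continuous_starHom {X : HilbertSpace.{w, v} 𝕜}
    (T : CrossedProduct μ 𝓗 →⋆ₙₐ[𝕜] (X →L[𝕜] X)) : Continuous T :=
  AddMonoidHomClass.continuous_of_bound T 1 fun a => by
    rw [one_mul]; exact norm_starHom_le T a

theorem starHom_ext {X : HilbertSpace.{w, v} 𝕜}
    {S T : CrossedProduct μ 𝓗 →⋆ₙₐ[𝕜] (X →L[𝕜] X)} (h : ∀ f, S (q μ 𝓗 f) = T (q μ 𝓗 f)) :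
    S = T :=
  DFunLike.coe_injective
    (denseRange_q.equalizer (continuous_starHom S) (continuous_starHom T) (funext h))

/-- By continuity of `T` and density of the range of `q`, each `T a x` is a limit of vectors `T (q
f) x`, so both spans have the same closure. -/
theorem isNondegenerate_comp_q_iff {X : HilbertSpace.{w, v} 𝕜}
    (T : CrossedProduct μ 𝓗 →⋆ₙₐ[𝕜] (X →L[𝕜] X)) :
    IsNondegenerate (T.comp (q μ 𝓗)) ↔ IsNondegenerate T := by
  refine ⟨fun h => h.mono (Submodule.span_mono ?_), fun h => ?_⟩
  · rintro _ ⟨f, x, rfl⟩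
    exact ⟨q μ 𝓗 f, x, rfl⟩
  · unfold IsNondegenerate at h ⊢
    rw [← dense_closure]
    refine h.mono ?_
    rw [← Submodule.topologicalClosure_coe]
    refine Submodule.span_le.2 ?_
    rintro _ ⟨a, x, rfl⟩
    have hc : Continuous fun a => T a x := (continuous_starHom T).clm_apply continuous_const
    refine closure_mono ?_ (hc.range_subset_closure_image_dense denseRange_q ⟨a, rfl⟩)
    rintro _ ⟨_, ⟨f, rfl⟩, rfl⟩
    exact Submodule.subset_span ⟨f, x, rfl⟩

end CrossedProduct

/-! ### Passage of invariant subspaces and intertwiners to the crossed product, by density. -/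

namespace UnitaryRep

variable (μ : Measure G) [μ.IsHaarMeasure] {𝓗 : Set (HilbertSpace.{w, v} 𝕜)} {X Y : 𝓗}

theorem crossedRep_comp_q (U : UnitaryRep G X.1) :
    U.crossedRep.comp (CrossedProduct.q μ 𝓗) = U.integratedForm :=
  DFunLike.ext _ _ U.crossedRep_q

theorem closedInvariantSubspaces_crossedRep (U : UnitaryRep G X.1) :
    closedInvariantSubspaces (fun a : CrossedProduct μ 𝓗 => U.crossedRep a) =
      closedInvariantSubspaces (fun s : G => U s) := by
  rw [← closedInvariantSubspaces_integratedForm μ]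
  ext Z
  refine and_congr_right fun hZ => ?_
  simp only [← crossedRep_q (𝓗 := 𝓗)]
  refine ⟨fun h f => h _, fun h a x hx => ?_⟩
  have hc : Continuous fun a : CrossedProduct μ 𝓗 => U.crossedRep a x :=
    U.crossedRepFun_continuous.clm_apply continuous_const
  exact CrossedProduct.denseRange_q.induction_on a (hZ.preimage hc) fun f => h f x hx

theorem intertwiners_crossedRep (U : UnitaryRep G X.1) (V : UnitaryRep G Y.1) :
    intertwiners (fun a : CrossedProduct μ 𝓗 => U.crossedRep a)
        (fun a : CrossedProduct μ 𝓗 => V.crossedRep a) =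
      intertwiners (fun s : G => U s) (fun s : G => V s) := by
  rw [← intertwiners_integratedForm μ]
  ext Φ
  change (∀ a : CrossedProduct μ 𝓗, V.crossedRep a ∘L Φ = Φ ∘L U.crossedRep a) ↔
    ∀ f : ConvAlg 𝕜 G μ, V.integratedForm f ∘L Φ = Φ ∘L U.integratedForm f
  simp only [← crossedRep_q (𝓗 := 𝓗)]
  refine ⟨fun h f => h _, fun h a => ?_⟩
  have hU : Continuous fun a : CrossedProduct μ 𝓗 => U.crossedRep a := U.crossedRepFun_continuous
  have hV : Continuous fun a : CrossedProduct μ 𝓗 => V.crossedRep a := V.crossedRepFun_continuous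
  exact CrossedProduct.denseRange_q.induction_on a
    (isClosed_eq (hV.clm_comp continuous_const) (continuous_const.clm_comp hU)) h

end UnitaryRep

/-! ### Recovering a unitary representation from a representation of `C_c(G)`. -/

section Disintegration

open ConvAlg TensorProduct

variable {μ : Measure G} [μ.IsHaarMeasure] {X : HilbertSpace.{w, v} 𝕜}
  (π : ConvAlg 𝕜 G μ →⋆ₙₐ[𝕜] (X →L[𝕜] X))

theorem continuous_starHom_translate (hπ : ∀ g, ‖π g‖ ≤ g.l1norm) (f : ConvAlg 𝕜 G μ) :
    Continuous fun s => π (translate s f) := by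
  refine continuous_iff_continuousAt.2 fun t => tendsto_iff_norm_sub_tendsto_zero.2 ?_
  have h := (continuous_l1norm_translate_sub f t).tendsto t
  have h0 : (translate t f - translate t f).l1norm = 0 := by simp [l1norm]
  rw [h0] at h
  refine squeeze_zero (fun _ => norm_nonneg _) (fun s => ?_) h
  rw [← map_sub]
  exact hπ _

/-- Formally `π` is applied under the integral `f * g = ∫ f(r) λ_r g dr`. To stay inside `C_c(G)`,
`f` is cut into pieces on which `r ↦ λ_r g` is nearly constant in `L¹`, where both sides are close
to `(∫ f) π(λ_t g) x`. -/
theorem starHom_mul_eq_integral [T2Space G] (hπ : ∀ g, ‖π g‖ ≤ g.l1norm) (f g : ConvAlg 𝕜 G μ)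
    (x : X) : π (f * g) x = ∫ r, f r • π (translate r g) x ∂μ := by
  have hc : Continuous fun r => π (translate r g) x :=
    (continuous_starHom_translate π hπ g).clm_apply continuous_const
  -- The defect of the identity is additive in `f`, so it can be bounded piece by piece.
  let Λ : ConvAlg 𝕜 G μ →+ X := AddMonoidHom.mk'
    (fun f => π (f * g) x - ∫ r, f r • π (translate r g) x ∂μ) (fun a b => by
      simp only [add_mul, map_add, ConvAlg.add_apply, add_smul, _root_.add_apply]
      rw [integral_add (a.integrable_smul hc) (b.integrable_smul hc)]
      abel)
  have hloc : ∀ (a : ConvAlg 𝕜 G μ) (t : G) (ε : ℝ),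
      (∀ r, a r ≠ 0 → (translate r g - translate t g).l1norm ≤ ε) →
      ‖Λ a‖ ≤ 2 * ε * ‖x‖ * a.l1norm := by
    intro a t ε h
    let c := ∫ r, a r ∂μ
    -- The common approximation `c • π (λ_t g) x` is subtracted from both terms; each remainder is
    -- at most `ε ‖x‖` times the `L¹`-norm of `a`, hence the factor 2.
    have e : Λ a = π (a * g - c • translate t g) x
        - ∫ r, a r • π (translate r g - translate t g) x ∂μ := by
      have e1 : ∫ r, a r • π (translate r g - translate t g) x ∂μ
          = (∫ r, a r • π (translate r g) x ∂μ) - c • π (translate t g) x := by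
        simp only [map_sub, _root_.sub_apply, smul_sub]
        rw [integral_sub (a.integrable_smul hc) (a.integrable_smul continuous_const),
          integral_smul_const]
      rw [e1, map_sub, map_smul]
      change _ = (π (a * g) x - c • π (translate t g) x) - _
      change π (a * g) x - _ = _
      abel
    have b1 : ‖π (a * g - c • translate t g) x‖ ≤ ε * a.l1norm * ‖x‖ :=
      (ContinuousLinearMap.le_opNorm _ _).trans (mul_le_mul_of_nonneg_right
        ((hπ _).trans (l1norm_mul_sub_le a g t h)) (norm_nonneg x))
    have b2 : ‖∫ r, a r • π (translate r g - translate t g) x ∂μ‖ ≤ ε * ‖x‖ * a.l1norm := by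
      have hi : Integrable (fun r => ε * ‖x‖ * ‖a r‖) μ :=
        (a.continuous.norm.integrable_of_hasCompactSupport a.hasCompactSupport.norm).const_mul _
      refine (norm_integral_le_of_norm_le hi (.of_forall fun r => ?_)).trans_eq
        (integral_const_mul _ _)
      by_cases hr : a r = 0
      · simp [hr]
      · rw [norm_smul, mul_comm]
        exact mul_le_mul_of_nonneg_right ((ContinuousLinearMap.le_opNorm _ _).trans
          (mul_le_mul_of_nonneg_right ((hπ _).trans (h r hr)) (norm_nonneg x))) (norm_nonneg _)
    rw [e]
    refine (norm_sub_le _ _).trans ((add_le_add b1 b2).trans_eq ?_)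
    ring
  have hglob : ∀ ε > 0, ‖Λ f‖ ≤ 2 * ε * ‖x‖ * f.l1norm := by
    intro ε hε
    obtain ⟨n, t, F, hF, hF1, hFV⟩ := exists_sum_eq_of_isOpen_cover f
      (V := fun t => {r | (translate r g - translate t g).l1norm < ε})
      (fun t => isOpen_lt (continuous_l1norm_translate_sub g t) continuous_const)
      (fun t => by simpa [l1norm] using hε)
    calc ‖Λ f‖ = ‖∑ i, Λ (F i)‖ := by rw [← _root_.map_sum, hF]
      _ ≤ ∑ i, 2 * ε * ‖x‖ * (F i).l1norm :=
        norm_sum_le_of_le _ fun i _ => hloc (F i) (t i) ε fun r hr => (hFV i r hr).le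
      _ = 2 * ε * ‖x‖ * f.l1norm := by rw [← Finset.mul_sum, hF1]
  have hlim : Filter.Tendsto (fun ε : ℝ => 2 * ε * ‖x‖ * f.l1norm) (𝓝[>] 0) (𝓝 0) := by
    have : Continuous fun ε : ℝ => 2 * ε * ‖x‖ * f.l1norm := by fun_prop
    simpa using (this.tendsto 0).mono_left nhdsWithin_le_nhds
  have h0 : ‖Λ f‖ ≤ 0 := ge_of_tendsto hlim (Filter.eventually_of_mem self_mem_nhdsWithin hglob)
  exact sub_eq_zero.1 (norm_le_zero_iff.1 h0)

/-- The linear map `f ⊗ x ↦ π f x`. -/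
noncomputable def actionMap : ConvAlg 𝕜 G μ ⊗[𝕜] X →ₗ[𝕜] X :=
  TensorProduct.lift (LinearMap.mk₂ 𝕜 (fun f x => π f x) (by simp) (by simp) (by simp) (by simp))

@[simp] theorem actionMap_tmul (f : ConvAlg 𝕜 G μ) (x : X) : actionMap π (f ⊗ₜ x) = π f x := rfl

/-- The linear map `f ⊗ x ↦ π (λ_s f) x`. -/
noncomputable def translatedActionMap (s : G) : ConvAlg 𝕜 G μ ⊗[𝕜] X →ₗ[𝕜] X :=
  actionMap π ∘ₗ LinearMap.rTensor X (translate s)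

@[simp] theorem translatedActionMap_tmul (s : G) (f : ConvAlg 𝕜 G μ) (x : X) :
    translatedActionMap π s (f ⊗ₜ x) = π (translate s f) x := rfl

/-- On elementary tensors, `⟪π f x, π g y⟫ = ⟪x, π (f⋆ * g) y⟫` depends on `f` and `g` only through
`f⋆ * g`, which is unchanged when both are translated. Working on the tensor product handles finite
sums before well-definedness on `X` is known; the resulting equality of norms supplies it. -/
theorem inner_translatedActionMap (s : G) (a b : ConvAlg 𝕜 G μ ⊗[𝕜] X) :
    inner 𝕜 (translatedActionMap π s a) (translatedActionMap π s b) =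
      inner 𝕜 (actionMap π a) (actionMap π b) := by
  have h : ∀ (f g : ConvAlg 𝕜 G μ) (x y : X), inner 𝕜 (π f x) (π g y) =
      inner 𝕜 x (π (star f * g) y) := by
    intro f g x y
    rw [map_mul, mul_apply_eq_comp, ← starHom_inner_star π (star f), star_star]
  induction a with
  | zero => simp
  | add a₁ a₂ h₁ h₂ => rw [map_add, map_add, inner_add_left, inner_add_left, h₁, h₂]
  | tmul f x =>
    induction b with
    | zero => simp
    | add b₁ b₂ h₁ h₂ => rw [map_add, map_add, inner_add_right, inner_add_right, h₁, h₂]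
    | tmul g y =>
      rw [translatedActionMap_tmul, translatedActionMap_tmul, actionMap_tmul, actionMap_tmul, h, h,
        star_translate_mul_translate]

theorem norm_translatedActionMap (s : G) (a : ConvAlg 𝕜 G μ ⊗[𝕜] X) :
    ‖translatedActionMap π s a‖ = ‖actionMap π a‖ := by
  rw [@norm_eq_sqrt_re_inner 𝕜, inner_translatedActionMap, ← @norm_eq_sqrt_re_inner 𝕜]

variable {π}

theorem IsNondegenerate.denseRange_actionMap (h : IsNondegenerate π) :
    DenseRange (actionMap π) := by
  refine Dense.mono ?_ h
  rw [← LinearMap.coe_range]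
  refine Submodule.span_le.2 ?_
  rintro _ ⟨f, x, rfl⟩
  exact ⟨f ⊗ₜ x, rfl⟩

theorem IsNondegenerate.ext_clm (h : IsNondegenerate π) {S T : X →L[𝕜] X}
    (H : ∀ f x, S (π f x) = T (π f x)) : S = T := by
  refine ContinuousLinearMap.ext_on h ?_
  rintro _ ⟨f, x, rfl⟩
  exact H f x

variable (π)

/-- The operator determined by `π f x ↦ π (λ_s f) x`. -/
noncomputable def translationOperator (s : G) : X →L[𝕜] X :=
  (translatedActionMap π s).extendOfNorm (actionMap π)

variable {π}

theorem IsNondegenerate.translationOperator_actionMap (h : IsNondegenerate π) (s : G)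
    (a : ConvAlg 𝕜 G μ ⊗[𝕜] X) :
    translationOperator π s (actionMap π a) = translatedActionMap π s a :=
  LinearMap.extendOfNorm_eq h.denseRange_actionMap
    ⟨1, fun a => by rw [one_mul, norm_translatedActionMap]⟩ a

theorem IsNondegenerate.translationOperator_apply (h : IsNondegenerate π) (s : G)
    (f : ConvAlg 𝕜 G μ) (x : X) :
    translationOperator π s (π f x) = π (translate s f) x :=
  h.translationOperator_actionMap s (f ⊗ₜ x)

theorem IsNondegenerate.norm_translationOperator_apply (h : IsNondegenerate π) (s : G) (x : X) :
    ‖translationOperator π s x‖ = ‖x‖ := by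
  refine h.denseRange_actionMap.induction_on x ?_ fun a => ?_
  · exact isClosed_eq (by fun_prop) continuous_norm
  · rw [h.translationOperator_actionMap, norm_translatedActionMap]

theorem IsNondegenerate.translationOperator_one (h : IsNondegenerate π) :
    translationOperator π 1 = 1 :=
  h.ext_clm fun f x => by
    rw [h.translationOperator_apply, translate_one, one_apply_eq_self]

theorem IsNondegenerate.translationOperator_mul (h : IsNondegenerate π) (s t : G) :
    translationOperator π (s * t) = translationOperator π s * translationOperator π t :=
  h.ext_clm fun f x => by
    rw [mul_apply_eq_comp, h.translationOperator_apply, h.translationOperator_apply,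
      h.translationOperator_apply, translate_mul]

theorem IsNondegenerate.translationOperator_mem_unitary (h : IsNondegenerate π) (s : G) :
    translationOperator π s ∈ unitary (X →L[𝕜] X) := by
  have h1 : star (translationOperator π s) * translationOperator π s = 1 :=
    (ContinuousLinearMap.norm_map_iff_adjoint_comp_self _).1 (h.norm_translationOperator_apply s)
  have h2 : translationOperator π s * translationOperator π s⁻¹ = 1 := by
    rw [← h.translationOperator_mul, mul_inv_cancel, h.translationOperator_one]
  refine Unitary.mem_iff.2 ⟨h1, ?_⟩
  -- The adjoint is a left inverse because the operator is isometric, and the operator at `s⁻¹` is a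
  -- right inverse; hence they coincide.
  rw [left_inv_eq_right_inv h1 h2, h2]

/-- The orbit maps are continuous for vectors in the dense range of `actionMap`. Isometry makes the
approximation of `x` by such vectors uniform in `s`. -/
theorem IsNondegenerate.continuous_translationOperator_apply (h : IsNondegenerate π)
    (hπ : ∀ g, ‖π g‖ ≤ g.l1norm) (x : X) : Continuous fun s => translationOperator π s x := by
  have hcont : ∀ a, Continuous fun s => translatedActionMap π s a := by
    intro a
    induction a with
    | zero => simpa using continuous_const
    | add a b ha hb => simp only [map_add]; exact ha.add hb
    | tmul f x => exact (continuous_starHom_translate π hπ f).clm_apply continuous_const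
  refine continuous_of_uniform_approx_of_continuous fun V hV => ?_
  obtain ⟨ε, hε, hV⟩ := Metric.mem_uniformity_dist.1 hV
  obtain ⟨a, ha⟩ := h.denseRange_actionMap.exists_dist_lt x hε
  refine ⟨_, hcont a, fun s => hV ?_⟩
  rwa [← h.translationOperator_actionMap, dist_eq_norm, ← map_sub,
    h.norm_translationOperator_apply, ← dist_eq_norm]

/-- The unitary representation `U` of `G` with `U s (π f x) = π (λ_s f) x`. -/
noncomputable def IsNondegenerate.unitaryRep (h : IsNondegenerate π)
    (hπ : ∀ g, ‖π g‖ ≤ g.l1norm) : UnitaryRep G X where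
  toHom :=
    { toFun := fun s => ⟨translationOperator π s, h.translationOperator_mem_unitary s⟩
      map_one' := Subtype.ext h.translationOperator_one
      map_mul' := fun s t => Subtype.ext (h.translationOperator_mul s t) }
  continuous_apply' := h.continuous_translationOperator_apply hπ

/-- On a vector `π g x`, both operators give `π (f * g) x = ∫ f(r) π(λ_r g) x dr`; such vectors span
a dense subspace. -/
theorem IsNondegenerate.integratedForm_unitaryRep [T2Space G] (h : IsNondegenerate π)
    (hπ : ∀ g, ‖π g‖ ≤ g.l1norm) : (h.unitaryRep hπ).integratedForm = π := by
  refine DFunLike.ext _ _ fun f => h.ext_clm fun g x => ?_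
  rw [← mul_apply_eq_comp (π f), ← map_mul, starHom_mul_eq_integral π hπ,
    UnitaryRep.integratedForm_apply]
  congr 1
  ext r
  congr 1
  exact h.translationOperator_apply r g x

end Disintegration

/-! ### The bijection, and the identification with the group C⋆-algebra. -/

theorem bijOn_crossedRep [T2Space G] (μ : Measure G) [μ.IsHaarMeasure]
    (𝓗 : Set (HilbertSpace.{w, v} 𝕜)) :
    Set.BijOn
      (fun U : UnitaryReps G 𝓗 =>
        (⟨U.1, U.2.crossedRep⟩ : (X : 𝓗) × (CrossedProduct μ 𝓗 →⋆ₙₐ[𝕜] (X.1 →L[𝕜] X.1))))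
      Set.univ {T | IsNondegenerate T.2} := by
  refine ⟨fun U _ => ?_, ?_, ?_⟩
  · refine (CrossedProduct.isNondegenerate_comp_q_iff _).1 ?_
    rw [UnitaryRep.crossedRep_comp_q]
    exact U.2.isNondegenerate_integratedForm
  · rintro ⟨X, U⟩ - ⟨Y, V⟩ - h
    obtain ⟨h1, h2⟩ := Sigma.mk.inj h
    obtain rfl : X = Y := h1
    congr 1
    refine UnitaryRep.integratedForm_injective (μ := μ) fun f => ?_
    rw [← U.crossedRep_q (𝓗 := 𝓗), ← V.crossedRep_q (𝓗 := 𝓗)]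
    exact DFunLike.congr_fun (eq_of_heq h2) _
  · rintro ⟨X, T⟩ hT
    have hn := (CrossedProduct.isNondegenerate_comp_q_iff T).2 hT
    -- Contractivity of `T` and `σ ≤ ‖·‖₁` make `T ∘ q` contractive for the `L¹`-norm, as
    -- disintegration requires.
    have hπ : ∀ g, ‖T.comp (CrossedProduct.q μ 𝓗) g‖ ≤ g.l1norm := fun g =>
      (norm_starHom_le T _).trans
        ((CrossedProduct.norm_q g).trans_le (CrossedProduct.sigma_le_l1norm g))
    refine ⟨⟨X, hn.unitaryRep hπ⟩, mem_univ _, ?_⟩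
    refine congrArg (Sigma.mk X) (CrossedProduct.starHom_ext fun f => ?_)
    rw [UnitaryRep.crossedRep_q, hn.integratedForm_unitaryRep hπ]
    rfl

/-- The non-degenerate `L¹`-contractive representations of `C_c(G)` are exactly the integrated
forms, so both suprema run over the same set of numbers. -/
theorem isLUB_groupCStarNorms [T2Space G] (μ : Measure G) [μ.IsHaarMeasure]
    (f : ConvAlg 𝕜 G μ) :
    IsLUB (groupCStarNorms.{w, u, v} f)
      ‖CrossedProduct.q μ (Set.univ : Set (HilbertSpace.{w, v} 𝕜)) f‖ := by
  have e : groupCStarNorms.{w, u, v} f = range fun U : UnitaryReps G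
      (Set.univ : Set (HilbertSpace.{w, v} 𝕜)) => ‖U.2.integratedForm f‖ := by
    ext c
    constructor
    · rintro ⟨X, π, hn, hπ, rfl⟩
      exact ⟨⟨⟨X, mem_univ X⟩, hn.unitaryRep hπ⟩, congrArg (‖· f‖) (hn.integratedForm_unitaryRep hπ)⟩
    · rintro ⟨U, rfl⟩
      exact ⟨U.1.1, U.2.integratedForm, U.2.isNondegenerate_integratedForm,
        U.2.norm_integratedForm_le, rfl⟩
  -- The representation on the zero space shows that the supremum is over a non-empty family, so
  -- that the real `⨆` is a genuine least upper bound.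
  have : Nonempty (UnitaryReps G (Set.univ : Set (HilbertSpace.{w, v} 𝕜))) :=
    ⟨⟨⟨⟨PUnit⟩, mem_univ _⟩, ⟨1, fun x => by simpa using continuous_const⟩⟩⟩
  rw [CrossedProduct.norm_q, e]
  exact isLUB_ciSup (bddAbove_norm μ _ f)

end GroupCrossed

theorem theoremt {𝕜 : Type w} [RCLike 𝕜] {G : Type u} [Group G] [TopologicalSpace G]
    [IsTopologicalGroup G] [LocallyCompactSpace G] [T2Space G] [MeasurableSpace G] [BorelSpace G]
    (μ : Measure G) [μ.IsHaarMeasure] (𝓗 : Set (HilbertSpace.{w, v} 𝕜)) (h𝓗 : 𝓗.Nonempty) :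
    -- `U ↦ U^𝓡` is a bijection from `𝓡` onto the non-degenerate involutive representations of the
    -- crossed product in spaces from `𝓗`
    Set.BijOn
      (fun U : UnitaryReps G 𝓗 =>
        (⟨U.1, U.2.crossedRep⟩ : (X : 𝓗) × (CrossedProduct μ 𝓗 →⋆ₙₐ[𝕜] (X.1 →L[𝕜] X.1))))
      Set.univ {T | IsNondegenerate T.2} ∧
    -- it preserves the closed invariant subspaces
    (∀ U : UnitaryReps G 𝓗,
      closedInvariantSubspaces (fun a : CrossedProduct μ 𝓗 => U.2.crossedRep a) =
        closedInvariantSubspaces (fun s : G => U.2 s)) ∧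
    -- it preserves the space of bounded intertwining operators
    (∀ U V : UnitaryReps G 𝓗,
      intertwiners (fun a : CrossedProduct μ 𝓗 => U.2.crossedRep a)
          (fun a : CrossedProduct μ 𝓗 => V.2.crossedRep a) =
        intertwiners (fun s : G => U.2 s) (fun s : G => V.2 s)) ∧
    -- if `𝓗` consists of all Hilbert spaces, then the crossed product is `C⋆(G)`
    (𝓗 = Set.univ → ∀ f : ConvAlg 𝕜 G μ,
      IsLUB (groupCStarNorms.{w, u, v} f) ‖CrossedProduct.q μ 𝓗 f‖) := by
  refine ⟨bijOn_crossedRep μ 𝓗, fun U => U.2.closedInvariantSubspaces_crossedRep μ,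
    fun U V => U.2.intertwiners_crossedRep μ V.2, ?_⟩
  rintro rfl f
  exact isLUB_groupCStarNorms μ f
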